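/- All states are unnormalised and nonzero. An orthogonal product set (OPS) in $\mathcal H=\bigotimes_i\mathcal H_i$ (finite-dimensional) is a set $\mathcal S$ of mutually orthogonal product states whose span $\mathcal H_{\mathcal S}$ is a proper subspace. It is an uncompletable product basis (UCPB) if $\mathcal H_{\mathcal S}^{\perp}$ contains fewer mutually orthogonal product states than its dimension; an unextendible product basis (UPB) if it is a UCPB and $\mathcal H_{\mathcal S}^{\perp}$ contains no product state; a strongly uncompletable product basis (SUCPB) if for every local extension $\mathcal H_{ext}=\bigotimes_i(\mathcal H_i\oplus\mathcal H_i')$ (finite-dimensional) the orthogonal complement of $\mathcal H_{\mathcal S}$ in $\mathcal H_{ext}$ contains fewer mutually orthogonal product states than its dimension. A $d_1\times d_2\times d_3$ tile structure is a partition of $\mathbb Z_{d_1}\times\mathbb Z_{d_2}\times\mathbb Z_{d_3}$, $\mathbb Z_n=\{0,\dots,n-1\}$, into nonempty subcubes (tiles) $\mathcal L\times\mathcal W\times\mathcal H$, whose index sets need not be intervals. A special cube is a subcube that is a union of at least two tiles. The structure is a U-tile structure if it has at least $5$ tiles and no special cube can be partitioned into two parts each of which is a special cube or a tile. Put $\omega_p=e^{2\pi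 i/p}$; for an index set $R=\{r_0<\dots<r_{p-1}\}$ let $|R,k\rangle=\sum_{e=0}^{p-1}\omega_p^{ke}|r_e\rangle$. The product set of a tile structure consists of the states $|\mathcal L,k\rangle|\mathcal W,l\rangle|\mathcal H,m\rangle$ over all tiles, $(k,l,m)\in\mathbb Z_{|\mathcal L|}\times\mathbb Z_{|\mathcal W|}\times\mathbb Z_{|\mathcal H|}\setminus\{(0,0,0)\}$, together with the stopper state $|S\rangle=\left(\sum_a|a\rangle\right)\left(\sum_b|b\rangle\right)\left(\sum_c|c\rangle\right)$. Let $d\ge3$ be odd. For $1\le k\le\frac{d-1}2$ and $1\le i\le d-2k$ put $|\alpha_i\rangle=\sum_{s=0}^{d-2k}\omega_{d-2k+1}^{is}|s+k-1\rangle$ and $|\beta_i\rangle=\sum_{s=0}^{d-2k}\omega_{d-2k+1}^{is}|s+k\rangle$. Let $\mathcal U^1\subset\mathbb C^d\otimes\mathbb C^d\otimes\mathbb C^2$ (parties $A,B,C$) consist of all the states $$|k-1\rangle|\alpha_i\rangle|0\rangle,\ |\alpha_i\rangle|d-k\rangle|0\rangle,\ |d-k\rangle|\beta_i\rangle|0\rangle,\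 |\beta_i\rangle|k-1\rangle|0\rangle,$$ $$|\alpha_i\rangle|k-1\rangle|1\rangle,\ |k-1\rangle|\beta_i\rangle|1\rangle,\ |\beta_i\rangle|d-k\rangle|1\rangle,\ |d-k\rangle|\alpha_i\rangle|1\rangle,$$ the state $|\frac{d-1}2\rangle|\frac{d-1}2\rangle(|0\rangle-|1\rangle)$, and the stopper state $|S\rangle$. Theorem. (1) Put $a_k=\{k-1,\dots,d-k-1\}$ and $b_k=\{k,\dots,d-k\}$. The $4d-3$ subcubes $$\{k-1\}\times a_k\times\{0\},\ a_k\times\{d-k\}\times\{0\},\ \{d-k\}\times b_k\times\{0\},\ b_k\times\{k-1\}\times\{0\},$$ $$a_k\times\{k-1\}\times\{1\},\ \{k-1\}\times b_k\times\{1\},\ b_k\times\{d-k\}\times\{1\},\ \{d-k\}\times a_k\times\{1\}$$ ($1\le k\le\frac{d-1}2$) and $\{\frac{d-1}2\}\times\{\frac{d-1}2\}\times\{0,1\}$ are pairwise distinct and form a $d\times d\times2$ U-tile structure, and $\mathcal U^1$ is its product set. (2) $\mathcal U^1$ is a UPB in $\mathbb C^d\otimes\mathbb C^d\otimes\mathbb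 C^2$ of size $2d^2-4d+4$. (3) $\mathcal U^1$ is an SUCPB in the bipartitions $A|BC$ and $B|CA$. -/

import Mathlib

open scoped TensorProduct

noncomputable section

/-! ### Product bases

States are not normalised.  The set `P` is the set of product states of the composite space `H`. -/

section ProductBases

variable {H : Type*} [NormedAddCommGroup H] [InnerProductSpace ℂ H]

/-- The vectors of `S` are mutually orthogonal. -/
def MutuallyOrthogonal (S : Set H) : Prop :=
  S.Pairwise fun u v => inner ℂ u v = 0

/-- The complementary subspace of the span of `S`. -/
def complementary (S : Set H) : Submodule ℂ H :=
  (Submodule.span ℂ S)ᗮ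

/-- Orthogonal product set: mutually orthogonal product states spanning a proper subspace. -/
def IsOPS (P S : Set H) : Prop :=
  S ⊆ P ∧ MutuallyOrthogonal S ∧ Submodule.span ℂ S ≠ ⊤

/-- The complementary subspace of `S` contains fewer mutually orthogonal product states than its
dimension. -/
def FewOrthogonalProducts (P S : Set H) : Prop :=
  ∀ T : Finset H, (T : Set H) ⊆ P → (∀ ψ ∈ T, ψ ∈ complementary S) →
    MutuallyOrthogonal (T : Set H) → T.card < Module.finrank ℂ (complementary S)

/-- Uncompletable product basis. -/
def IsUCPB (P S : Set H) : Prop :=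
  IsOPS P S ∧ FewOrthogonalProducts P S

/-- Unextendible product basis. -/
def IsUPB (P S : Set H) : Prop :=
  IsUCPB P S ∧ ∀ ψ ∈ P, ψ ∉ complementary S

end ProductBases

section Tensor

variable (E F G : Type*)
  [NormedAddCommGroup E] [InnerProductSpace ℂ E]
  [NormedAddCommGroup F] [InnerProductSpace ℂ F]
  [NormedAddCommGroup G] [InnerProductSpace ℂ G]

/-- Product states of a bipartite system. -/
def productStates₂ : Set (E ⊗[ℂ] F) :=
  {ψ | ∃ (x : E) (y : F), x ≠ 0 ∧ y ≠ 0 ∧ ψ = x ⊗ₜ[ℂ] y}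

/-- Product states of a tripartite system. -/
def productStates₃ : Set (E ⊗[ℂ] (F ⊗[ℂ] G)) :=
  {ψ | ∃ (x : E) (y : F) (z : G), x ≠ 0 ∧ y ≠ 0 ∧ z ≠ 0 ∧ ψ = x ⊗ₜ[ℂ] (y ⊗ₜ[ℂ] z)}

variable {E F}

/-- Strongly uncompletable product basis of a bipartite system: in every local extension of the
Hilbert space (each party's space is embedded isometrically in a larger finite-dimensional Hilbert
space), the complementary subspace contains fewer mutually orthogonal product states than its
dimension. -/
def IsSUCPB (S : Set (E ⊗[ℂ] F)) : Prop :=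
  IsOPS (productStates₂ E F) S ∧
    ∀ (m n : ℕ) (f : E →ₗᵢ[ℂ] EuclideanSpace ℂ (Fin m)) (g : F →ₗᵢ[ℂ] EuclideanSpace ℂ (Fin n)),
      FewOrthogonalProducts
        (productStates₂ (EuclideanSpace ℂ (Fin m)) (EuclideanSpace ℂ (Fin n)))
        (TensorProduct.map f.toLinearMap g.toLinearMap '' S)

variable {G}

/-- A set of tripartite states is an SUCPB in the bipartition `A|BC`. -/
def IsSUCPB_A_BC (S : Set (E ⊗[ℂ] (F ⊗[ℂ] G))) : Prop :=
  IsSUCPB S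

/-- The reordering of the parties `x ⊗ (y ⊗ z) ↦ y ⊗ (z ⊗ x)`. -/
def rotateABC : E ⊗[ℂ] (F ⊗[ℂ] G) ≃ₗ[ℂ] F ⊗[ℂ] (G ⊗[ℂ] E) :=
  (TensorProduct.comm ℂ E (F ⊗[ℂ] G)).trans (TensorProduct.assoc ℂ F G E)

/-- A set of tripartite states is an SUCPB in the bipartition `B|CA`. -/
def IsSUCPB_B_CA (S : Set (E ⊗[ℂ] (F ⊗[ℂ] G))) : Prop :=
  IsSUCPB (rotateABC '' S)

end Tensor

/-! ### Tile structures -/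

/-- A subcube `L × W × H` of the `d₁ × d₂ × d₃` cube, given by its index sets (which need not be
intervals). -/
abbrev Subcube (d₁ d₂ d₃ : ℕ) : Type :=
  Finset (Fin d₁) × Finset (Fin d₂) × Finset (Fin d₃)

/-- The set of cells of a subcube. -/
def cells {d₁ d₂ d₃ : ℕ} (t : Subcube d₁ d₂ d₃) : Finset (Fin d₁ × Fin d₂ × Fin d₃) :=
  t.1 ×ˢ (t.2.1 ×ˢ t.2.2)

/-- The subcubes in `T` (the tiles) are nonempty and partition the whole cube. -/
def IsTileStructure {d₁ d₂ d₃ : ℕ} (T : Finset (Subcube d₁ d₂ d₃)) : Prop :=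
  (∀ t ∈ T, (cells t).Nonempty) ∧
    (∀ s ∈ T, ∀ t ∈ T, s ≠ t → Disjoint (cells s) (cells t)) ∧
    ∀ c : Fin d₁ × Fin d₂ × Fin d₃, ∃ t ∈ T, c ∈ cells t

/-- A special cube of `T` is a subcube that consists of at least two tiles. -/
def IsSpecialCube {d₁ d₂ d₃ : ℕ} (T : Finset (Subcube d₁ d₂ d₃)) (C : Subcube d₁ d₂ d₃) : Prop :=
  ∃ T' ⊆ T, 2 ≤ T'.card ∧ cells C = T'.biUnion cells

/-- A U-tile structure: a tile structure with at least five tiles in which no special cube can be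
partitioned into two parts each of which is a special cube or a tile. -/
def IsUTileStructure {d₁ d₂ d₃ : ℕ} (T : Finset (Subcube d₁ d₂ d₃)) : Prop :=
  IsTileStructure T ∧ 5 ≤ T.card ∧
    ∀ C, IsSpecialCube T C →
      ¬ ∃ R S : Subcube d₁ d₂ d₃, (IsSpecialCube T R ∨ R ∈ T) ∧ (IsSpecialCube T S ∨ S ∈ T) ∧
        Disjoint (cells R) (cells S) ∧ cells C = cells R ∪ cells S

/-! ### The product set of a tile structure -/

/-- `omegaRoot n = exp (2πi / n)`. -/
def omegaRoot (n : ℕ) : ℂ :=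
  Complex.exp (2 * Real.pi * Complex.I / n)

/-- `∑ₑ ω_p ^ (k e) |r_e⟩` for the index set `R = {r_0 < r_1 < ⋯ < r_{p-1}}`. -/
def fourierState {d : ℕ} (R : Finset (Fin d)) (k : ℕ) : EuclideanSpace ℂ (Fin d) :=
  WithLp.toLp 2 fun j => if j ∈ R then omegaRoot R.card ^ (k * (R.filter (· < j)).card) else 0

/-- The stopper state `∑ |a⟩ ⊗ ∑ |b⟩ ⊗ ∑ |c⟩`. -/
def stopper (d₁ d₂ d₃ : ℕ) :
    EuclideanSpace ℂ (Fin d₁) ⊗[ℂ] (EuclideanSpace ℂ (Fin d₂) ⊗[ℂ] EuclideanSpace ℂ (Fin d₃)) :=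
  (WithLp.toLp 2 fun _ => 1) ⊗ₜ[ℂ] ((WithLp.toLp 2 fun _ => 1) ⊗ₜ[ℂ] (WithLp.toLp 2 fun _ => 1))

/-- The Fourier product states of a tile, without the one of index `(0, 0, 0)`. -/
def tileStates {d₁ d₂ d₃ : ℕ} (t : Subcube d₁ d₂ d₃) :
    Set (EuclideanSpace ℂ (Fin d₁) ⊗[ℂ]
      (EuclideanSpace ℂ (Fin d₂) ⊗[ℂ] EuclideanSpace ℂ (Fin d₃))) :=
  {ψ | ∃ k l m : ℕ, k < t.1.card ∧ l < t.2.1.card ∧ m < t.2.2.card ∧ (k, l, m) ≠ (0, 0, 0) ∧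
    ψ = fourierState t.1 k ⊗ₜ[ℂ] (fourierState t.2.1 l ⊗ₜ[ℂ] fourierState t.2.2 m)}

/-- The set of product states that corresponds to a tile structure. -/
def tileProductSet {d₁ d₂ d₃ : ℕ} (T : Finset (Subcube d₁ d₂ d₃)) :
    Set (EuclideanSpace ℂ (Fin d₁) ⊗[ℂ]
      (EuclideanSpace ℂ (Fin d₂) ⊗[ℂ] EuclideanSpace ℂ (Fin d₃))) :=
  (⋃ t ∈ T, tileStates t) ∪ {stopper d₁ d₂ d₃}

/-! ### The layered set for odd `d`

The layers are `1 ≤ k ≤ (d - 1) / 2`, so all subtractions below are genuine. -/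

/-- The computational basis state `|n⟩` of `ℂ^d` (used only for `n < d`). -/
def ket (d n : ℕ) : EuclideanSpace ℂ (Fin d) :=
  WithLp.toLp 2 fun j => if (j : ℕ) = n then 1 else 0

/-- `|α_i⟩ = ∑_{s=0}^{d-2k} ω_{d-2k+1}^{is} |s+k-1⟩`. -/
def alphaState (d k i : ℕ) : EuclideanSpace ℂ (Fin d) :=
  ∑ s ∈ Finset.range (d - 2 * k + 1), omegaRoot (d - 2 * k + 1) ^ (i * s) • ket d (s + k - 1)

/-- `|β_i⟩ = ∑_{s=0}^{d-2k} ω_{d-2k+1}^{is} |s+k⟩`. -/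
def betaState (d k i : ℕ) : EuclideanSpace ℂ (Fin d) :=
  ∑ s ∈ Finset.range (d - 2 * k + 1), omegaRoot (d - 2 * k + 1) ^ (i * s) • ket d (s + k)

/-- The union of the eight sets of states of the `k`-th layer. -/
def layerStates (d k : ℕ) :
    Set (EuclideanSpace ℂ (Fin d) ⊗[ℂ]
      (EuclideanSpace ℂ (Fin d) ⊗[ℂ] EuclideanSpace ℂ (Fin 2))) :=
  {ψ | ∃ i : ℕ, 1 ≤ i ∧ i ≤ d - 2 * k ∧
    (ψ = ket d (k - 1) ⊗ₜ[ℂ] (alphaState d k i ⊗ₜ[ℂ] ket 2 0) ∨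
     ψ = alphaState d k i ⊗ₜ[ℂ] (ket d (d - k) ⊗ₜ[ℂ] ket 2 0) ∨
     ψ = ket d (d - k) ⊗ₜ[ℂ] (betaState d k i ⊗ₜ[ℂ] ket 2 0) ∨
     ψ = betaState d k i ⊗ₜ[ℂ] (ket d (k - 1) ⊗ₜ[ℂ] ket 2 0) ∨
     ψ = alphaState d k i ⊗ₜ[ℂ] (ket d (k - 1) ⊗ₜ[ℂ] ket 2 1) ∨
     ψ = ket d (k - 1) ⊗ₜ[ℂ] (betaState d k i ⊗ₜ[ℂ] ket 2 1) ∨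
     ψ = betaState d k i ⊗ₜ[ℂ] (ket d (d - k) ⊗ₜ[ℂ] ket 2 1) ∨
     ψ = ket d (d - k) ⊗ₜ[ℂ] (alphaState d k i ⊗ₜ[ℂ] ket 2 1))}

/-- The state of the centre tile. -/
def centreState (d : ℕ) :
    EuclideanSpace ℂ (Fin d) ⊗[ℂ]
      (EuclideanSpace ℂ (Fin d) ⊗[ℂ] EuclideanSpace ℂ (Fin 2)) :=
  ket d ((d - 1) / 2) ⊗ₜ[ℂ] (ket d ((d - 1) / 2) ⊗ₜ[ℂ] (ket 2 0 - ket 2 1))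

/-- The set `𝒰¹` (for odd `d`). -/
def U1 (d : ℕ) :
    Set (EuclideanSpace ℂ (Fin d) ⊗[ℂ]
      (EuclideanSpace ℂ (Fin d) ⊗[ℂ] EuclideanSpace ℂ (Fin 2))) :=
  (⋃ k ∈ Finset.Icc 1 ((d - 1) / 2), layerStates d k) ∪ {centreState d} ∪ {stopper d d 2}

/-- The index set `{a, a + 1, …, b}` in `Fin d`. -/
def indexRange (d a b : ℕ) : Finset (Fin d) :=
  Finset.univ.filter fun j => a ≤ (j : ℕ) ∧ (j : ℕ) ≤ b

/-- The index set `{n}` in `Fin d`. -/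
def indexPoint (d n : ℕ) : Finset (Fin d) :=
  Finset.univ.filter fun j => (j : ℕ) = n

/-- The eight tiles of the `k`-th layer. -/
def layerTiles (d k : ℕ) : Finset (Subcube d d 2) :=
  {(indexPoint d (k - 1), indexRange d (k - 1) (d - k - 1), {0}),
   (indexRange d (k - 1) (d - k - 1), indexPoint d (d - k), {0}),
   (indexPoint d (d - k), indexRange d k (d - k), {0}),
   (indexRange d k (d - k), indexPoint d (k - 1), {0}),
   (indexRange d (k - 1) (d - k - 1), indexPoint d (k - 1), {1}),
   (indexPoint d (k - 1), indexRange d k (d - k), {1}),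
   (indexRange d k (d - k), indexPoint d (d - k), {1}),
   (indexPoint d (d - k), indexRange d (k - 1) (d - k - 1), {1})}

/-- The layered tile structure: eight tiles in each layer and the centre tile. -/
def layeredTiles (d : ℕ) : Finset (Subcube d d 2) :=
  (Finset.Icc 1 ((d - 1) / 2)).biUnion (layerTiles d) ∪
    {(indexPoint d ((d - 1) / 2), indexPoint d ((d - 1) / 2), Finset.univ)}

end

/-! Expand a state in the computational basis. Orthogonality to the Fourier states of a tile, the
one of index zero excepted, forces the amplitudes to be constant on that tile
(`inner_cellState_congr`). Since the stopper is the sum of all cell states, orthogonality to it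
makes the amplitudes sum to zero. So the complementary subspace consists of the tile-constant
functions with sum zero, and the question is which product functions are of this kind.

Put the origin at the middle index. Apart from the centre tile, every tile is a segment of a row or
of a column: for a signed index `a` it covers `[-|a|, |a|]` except the point `-a` (`InLine`), so it
always crosses an axis. The two planes carry opposite orientations. Two facts follow.

First, if a bipartite product function is tile-constant and nonzero at the centre, both factors are
constant on one symmetric interval `[-q, q]` and vanish outside it
(`PinwheelConstant.exists_frame`). Its sum is then nonzero, so every product state for `A|BC` in the
complementary subspace vanishes at the centre. Reflection in the diagonal, combined with exchange of
the planes, preserves the tiling and gives the same for `B|CA`.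

Second, a tripartite tile-constant product function that vanishes at the centre is supported in a
single tile (`ConstantOnTiles.exists_tile`). If it is not zero its sum is not zero either, which
excludes all product states and gives the UPB property. Applied to indicator functions of boxes, the
same fact puts the centre into every special cube, and the U-property follows.

For strong uncompletability, the amplitude at the centre is a linear functional that kills all
product states of the complementary subspace but not the subspace itself.
`fewOrthogonalProducts_of_functional` carries this obstruction to every local extension through the
adjoint of the embedding. -/

/-! ### Fourier states on an index set -/

theorem omegaRoot_isPrimitiveRoot {n : ℕ} (hn : n ≠ 0) : IsPrimitiveRoot (omegaRoot n) n :=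
  Complex.isPrimitiveRoot_exp n hn

theorem conj_omegaRoot (n : ℕ) : starRingEnd ℂ (omegaRoot n) = (omegaRoot n)⁻¹ := by
  unfold omegaRoot
  rw [← Complex.exp_conj, ← Complex.exp_neg]
  congr 1
  simp [neg_div, map_ofNat]

theorem omegaRoot_ne_zero (n : ℕ) : omegaRoot n ≠ 0 := Complex.exp_ne_zero _

/-- The summand is the `s`-th power of `ω ^ b / ω ^ a`, an `n`-th root of unity that differs from 1
when `a ≠ b` because `ω` is primitive. -/
theorem sum_omegaRoot_pow {n a b : ℕ} (ha : a < n) (hb : b < n) :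
    ∑ s ∈ Finset.range n, starRingEnd ℂ (omegaRoot n ^ (a * s)) * omegaRoot n ^ (b * s) =
      if a = b then (n : ℂ) else 0 := by
  have hn : n ≠ 0 := by omega
  have hω := omegaRoot_isPrimitiveRoot hn
  have hterm : ∀ s, starRingEnd ℂ (omegaRoot n ^ (a * s)) * omegaRoot n ^ (b * s) =
      (omegaRoot n ^ b / omegaRoot n ^ a) ^ s := by
    intro s
    rw [map_pow, conj_omegaRoot, div_pow, ← pow_mul, ← pow_mul, inv_pow, div_eq_inv_mul]
  simp_rw [hterm]
  split_ifs with h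
  · subst h
    simp [div_self (pow_ne_zero a (omegaRoot_ne_zero n))]
  · have h1 : omegaRoot n ^ b / omegaRoot n ^ a ≠ 1 := by
      intro h1
      rw [div_eq_one_iff_eq (pow_ne_zero _ (omegaRoot_ne_zero n))] at h1
      exact h (hω.pow_inj hb ha h1).symm
    rw [geom_sum_eq h1, div_pow, ← pow_mul, ← pow_mul, mul_comm b, mul_comm a, pow_mul, pow_mul,
      hω.pow_eq_one]
    simp

/-- The number of elements of `R` below `j`. -/
abbrev rankIn {d : ℕ} (R : Finset (Fin d)) (j : Fin d) : ℕ := (R.filter (· < j)).card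

theorem rankIn_lt {d : ℕ} {R : Finset (Fin d)} {j : Fin d} (hj : j ∈ R) : rankIn R j < R.card :=
  Finset.card_lt_card ⟨Finset.filter_subset _ _, fun h => by simpa using h hj⟩

theorem rankIn_injOn {d : ℕ} (R : Finset (Fin d)) : Set.InjOn (rankIn R) R := by
  have key : ∀ i ∈ R, ∀ j ∈ R, i < j → rankIn R i < rankIn R j := by
    intro i hi j hj hij
    refine Finset.card_lt_card ⟨fun x hx => ?_, fun h => ?_⟩
    · simp only [Finset.mem_filter] at hx ⊢
      exact ⟨hx.1, hx.2.trans hij⟩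
    · have := h (Finset.mem_filter.2 ⟨hi, hij⟩)
      simp at this
  intro i hi j hj h
  rcases lt_trichotomy i j with hlt | heq | hlt
  · exact absurd h (key i hi j hj hlt).ne
  · exact heq
  · exact absurd h (key j hj i hi hlt).ne'

/-- The rank is a bijection from `R` onto an initial segment, so index sets with gaps behave like
intervals. -/
theorem sum_rankIn {d : ℕ} (R : Finset (Fin d)) (f : ℕ → ℂ) :
    ∑ j ∈ R, f (rankIn R j) = ∑ s ∈ Finset.range R.card, f s := by
  have himg : R.image (rankIn R) = Finset.range R.card := by
    refine Finset.eq_of_subset_of_card_le (fun s hs => ?_) ?_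
    · obtain ⟨j, hj, rfl⟩ := Finset.mem_image.1 hs
      exact Finset.mem_range.2 (rankIn_lt hj)
    · rw [Finset.card_image_of_injOn (rankIn_injOn R), Finset.card_range]
  rw [← himg, Finset.sum_image (rankIn_injOn R)]

theorem fourierState_apply {d : ℕ} (R : Finset (Fin d)) (k : ℕ) (j : Fin d) :
    fourierState R k j = if j ∈ R then omegaRoot R.card ^ (k * rankIn R j) else 0 := rfl

theorem fourierState_zero_apply {d : ℕ} (R : Finset (Fin d)) (j : Fin d) :
    fourierState R 0 j = if j ∈ R then 1 else 0 := by
  simp [fourierState_apply]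

theorem inner_fourierState {d : ℕ} (R : Finset (Fin d)) {k l : ℕ} (hk : k < R.card)
    (hl : l < R.card) :
    inner ℂ (fourierState R k) (fourierState R l) = if k = l then (R.card : ℂ) else 0 := by
  rw [← sum_omegaRoot_pow hk hl, ← sum_rankIn R, PiLp.inner_apply,
    ← Finset.sum_subset (Finset.subset_univ R)]
  · refine Finset.sum_congr rfl fun j hj => ?_
    rw [fourierState_apply, fourierState_apply, if_pos hj, if_pos hj, RCLike.inner_apply, mul_comm]
  · intro j _ hj
    simp [fourierState_apply, hj]

theorem inner_fourierState_of_disjoint {d : ℕ} {R R' : Finset (Fin d)} (h : Disjoint R R')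
    (k l : ℕ) : inner ℂ (fourierState R k) (fourierState R' l) = 0 := by
  rw [PiLp.inner_apply]
  refine Finset.sum_eq_zero fun j _ => ?_
  by_cases hj : j ∈ R
  · simp [fourierState_apply, Finset.disjoint_left.1 h hj]
  · simp [fourierState_apply, hj]

theorem inner_fourierState_univ {d : ℕ} (R : Finset (Fin d)) {k : ℕ} (hk : k < R.card) :
    inner ℂ (fourierState Finset.univ 0) (fourierState R k) =
      if k = 0 then (R.card : ℂ) else 0 := by
  have h := inner_fourierState R (show 0 < R.card by omega) hk
  simp only [@eq_comm _ 0 k] at h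
  rw [← h, PiLp.inner_apply, PiLp.inner_apply]
  refine Finset.sum_congr rfl fun j _ => ?_
  by_cases hj : j ∈ R <;> simp [fourierState_apply, hj]

/-- Fourier inversion on `R`, kept free of division by scaling with the cardinality. -/
theorem card_smul_single {d : ℕ} {R : Finset (Fin d)} {i : Fin d} (hi : i ∈ R) :
    (R.card : ℂ) • EuclideanSpace.single i (1 : ℂ) =
      ∑ k ∈ Finset.range R.card,
        starRingEnd ℂ (omegaRoot R.card ^ (k * rankIn R i)) • fourierState R k := by
  ext j
  simp only [PiLp.smul_apply, PiLp.single_apply, smul_eq_mul, WithLp.ofLp_sum,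
    Finset.sum_apply, fourierState_apply]
  by_cases hj : j ∈ R
  -- Frequency and rank enter symmetrically, so the orthogonality relation applies with the two
  -- ranks in the role of frequencies.
  · simp only [if_pos hj, mul_comm _ (rankIn R _)]
    rw [sum_omegaRoot_pow (rankIn_lt hi) (rankIn_lt hj)]
    by_cases hij : j = i
    · simp [hij]
    · have : rankIn R i ≠ rankIn R j := fun h => hij (rankIn_injOn R hi hj h).symm
      simp [hij, this]
  · have : j ≠ i := by rintro rfl; exact hj hi
    simp [hj, this]

local notation "innerC" =>
  @inner ℂ _ (@InnerProductSpace.toInner ℂ _ _ NormedAddCommGroup.toSeminormedAddCommGroup _)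

theorem innerC_tmul {E F : Type*} [NormedAddCommGroup E] [InnerProductSpace ℂ E]
    [NormedAddCommGroup F] [InnerProductSpace ℂ F] (x x' : E) (y y' : F) :
    innerC (x ⊗ₜ[ℂ] y) (x' ⊗ₜ[ℂ] y') = innerC x x' * innerC y y' :=
  TensorProduct.inner_tmul ..


theorem sum_tmul_sum_tmul_sum {E F G ι κ μ : Type*} [AddCommGroup E] [Module ℂ E]
    [AddCommGroup F] [Module ℂ F] [AddCommGroup G] [Module ℂ G]
    (r : Finset ι) (s : Finset κ) (t : Finset μ) (x : ι → E) (y : κ → F) (z : μ → G) :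
    (∑ i ∈ r, x i) ⊗ₜ[ℂ] ((∑ j ∈ s, y j) ⊗ₜ[ℂ] ∑ k ∈ t, z k) =
      ∑ p ∈ r ×ˢ (s ×ˢ t), x p.1 ⊗ₜ[ℂ] (y p.2.1 ⊗ₜ[ℂ] z p.2.2) := by
  rw [TensorProduct.sum_tmul, Finset.sum_product]
  refine Finset.sum_congr rfl fun i _ => ?_
  rw [TensorProduct.sum_tmul, TensorProduct.tmul_sum, Finset.sum_product]
  refine Finset.sum_congr rfl fun j _ => ?_
  rw [TensorProduct.tmul_sum, TensorProduct.tmul_sum]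

theorem inner_smul_sub_smul {H : Type*} [NormedAddCommGroup H] [InnerProductSpace ℂ H]
    (x y z : H) (a b : ℂ) :
    innerC x (a • y - b • z) = a * innerC x y - b * innerC x z := by
  rw [inner_sub_right, inner_smul_right, inner_smul_right]

theorem natCast_mul_inner_eq_of_smul_eq_sum {H ι : Type*} [NormedAddCommGroup H]
    [InnerProductSpace ℂ H] {x ψ : H} {n : ℕ} {s : Finset ι} {a : ι → ℂ} {v : ι → H} {k₀ : ι}
    (h : (n : ℂ) • x = ∑ k ∈ s, a k • v k) (hk₀ : k₀ ∈ s) (ha : a k₀ = 1)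
    (hv : ∀ k ∈ s, k ≠ k₀ → innerC (v k) ψ = 0) :
    (n : ℂ) * innerC x ψ = innerC (v k₀) ψ := by
  have hinner := congrArg (fun φ => innerC φ ψ) h
  simp only [inner_smul_left, sum_inner, map_natCast] at hinner
  rw [hinner, Finset.sum_eq_single_of_mem k₀ hk₀ fun k hk hne => by rw [hv k hk hne, mul_zero],
    ha, map_one, one_mul]

/-! ### States of a general tile structure and their complementary subspace -/

section TileStates

variable {d₁ d₂ d₃ : ℕ}

/-- The tripartite space with local dimensions `d₁`, `d₂`, `d₃`. -/
abbrev TripartiteSpace (d₁ d₂ d₃ : ℕ) : Type :=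
  EuclideanSpace ℂ (Fin d₁) ⊗[ℂ] (EuclideanSpace ℂ (Fin d₂) ⊗[ℂ] EuclideanSpace ℂ (Fin d₃))

/-- The Fourier product state of a tile with a given index. -/
noncomputable def tileState (t : Subcube d₁ d₂ d₃) (k : ℕ × ℕ × ℕ) : TripartiteSpace d₁ d₂ d₃ :=
  fourierState t.1 k.1 ⊗ₜ[ℂ] (fourierState t.2.1 k.2.1 ⊗ₜ[ℂ] fourierState t.2.2 k.2.2)

/-- The computational basis state of a cell. -/
noncomputable def cellState (c : Fin d₁ × Fin d₂ × Fin d₃) : TripartiteSpace d₁ d₂ d₃ :=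
  EuclideanSpace.single c.1 1 ⊗ₜ[ℂ]
    (EuclideanSpace.single c.2.1 1 ⊗ₜ[ℂ] EuclideanSpace.single c.2.2 1)

/-- The indices of the Fourier product states of a tile. -/
def tileIndex (t : Subcube d₁ d₂ d₃) : Finset (ℕ × ℕ × ℕ) :=
  Finset.range t.1.card ×ˢ (Finset.range t.2.1.card ×ˢ Finset.range t.2.2.card)

theorem mem_tileIndex {t : Subcube d₁ d₂ d₃} {k : ℕ × ℕ × ℕ} :
    k ∈ tileIndex t ↔ k.1 < t.1.card ∧ k.2.1 < t.2.1.card ∧ k.2.2 < t.2.2.card := by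
  simp [tileIndex]

theorem card_tileIndex (t : Subcube d₁ d₂ d₃) : (tileIndex t).card = (cells t).card := by
  simp [tileIndex, cells]

theorem mem_cells {t : Subcube d₁ d₂ d₃} {c : Fin d₁ × Fin d₂ × Fin d₃} :
    c ∈ cells t ↔ c.1 ∈ t.1 ∧ c.2.1 ∈ t.2.1 ∧ c.2.2 ∈ t.2.2 := by
  simp [cells]

theorem zero_mem_tileIndex {t : Subcube d₁ d₂ d₃} (ht : (cells t).Nonempty) :
    (0, 0, 0) ∈ tileIndex t := by
  obtain ⟨c, hc⟩ := ht
  rw [mem_cells] at hc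
  exact mem_tileIndex.2 ⟨Finset.card_pos.2 ⟨_, hc.1⟩, Finset.card_pos.2 ⟨_, hc.2.1⟩,
    Finset.card_pos.2 ⟨_, hc.2.2⟩⟩

theorem tileStates_eq (t : Subcube d₁ d₂ d₃) :
    tileStates t = tileState t '' ((tileIndex t).erase (0, 0, 0) : Finset (ℕ × ℕ × ℕ)) := by
  ext ψ
  simp only [tileStates, Set.mem_ofPred_eq, Set.mem_image, Finset.mem_coe, Finset.mem_erase,
    mem_tileIndex, tileState, Prod.exists]
  constructor
  · rintro ⟨k, l, m, hk, hl, hm, hne, rfl⟩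
    exact ⟨k, l, m, ⟨hne, hk, hl, hm⟩, rfl⟩
  · rintro ⟨k, l, m, ⟨hne, hk, hl, hm⟩, rfl⟩
    exact ⟨k, l, m, hk, hl, hm, hne, rfl⟩

theorem inner_tileState (t : Subcube d₁ d₂ d₃) {k l : ℕ × ℕ × ℕ} (hk : k ∈ tileIndex t)
    (hl : l ∈ tileIndex t) :
    innerC (tileState t k) (tileState t l) = if k = l then ((cells t).card : ℂ) else 0 := by
  rw [mem_tileIndex] at hk hl
  rw [tileState, tileState, innerC_tmul, innerC_tmul,
    inner_fourierState _ hk.1 hl.1, inner_fourierState _ hk.2.1 hl.2.1,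
    inner_fourierState _ hk.2.2 hl.2.2]
  obtain ⟨k1, k2, k3⟩ := k
  obtain ⟨l1, l2, l3⟩ := l
  by_cases h1 : k1 = l1 <;> by_cases h2 : k2 = l2 <;> by_cases h3 : k3 = l3 <;>
    simp [h1, h2, h3, cells]

/-- Disjoint boxes already have disjoint index sets in one of the three factors, and that factor
makes the inner product vanish. -/
theorem inner_tileState_of_disjoint {s t : Subcube d₁ d₂ d₃} (h : Disjoint (cells s) (cells t))
    (k l : ℕ × ℕ × ℕ) : innerC (tileState s k) (tileState t l) = 0 := by
  rw [tileState, tileState, innerC_tmul, innerC_tmul]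
  rw [cells, cells, Finset.disjoint_product, Finset.disjoint_product] at h
  rcases h with h | h | h <;> rw [inner_fourierState_of_disjoint h] <;> simp

theorem stopper_eq : stopper d₁ d₂ d₃ = tileState (Finset.univ, Finset.univ, Finset.univ) 0 := by
  have h : ∀ d : ℕ, (WithLp.toLp 2 fun _ => 1 : EuclideanSpace ℂ (Fin d)) =
      fourierState Finset.univ 0 := by
    intro d; ext j; simp [fourierState_apply]
  simp only [stopper, tileState, h]
  rfl

theorem inner_stopper (t : Subcube d₁ d₂ d₃) {k : ℕ × ℕ × ℕ} (hk : k ∈ tileIndex t) :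
    innerC (stopper d₁ d₂ d₃) (tileState t k) =
      if k = (0, 0, 0) then ((cells t).card : ℂ) else 0 := by
  rw [mem_tileIndex] at hk
  rw [stopper_eq, tileState, tileState, innerC_tmul, innerC_tmul]
  obtain ⟨k1, k2, k3⟩ := k
  simp only [Prod.fst_zero, Prod.snd_zero] at hk ⊢
  rw [inner_fourierState_univ _ hk.1, inner_fourierState_univ _ hk.2.1,
    inner_fourierState_univ _ hk.2.2]
  by_cases h1 : k1 = 0 <;> by_cases h2 : k2 = 0 <;> by_cases h3 : k3 = 0 <;>
    simp [h1, h2, h3, cells]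

theorem inner_cellState_tmul (c : Fin d₁ × Fin d₂ × Fin d₃) (x : EuclideanSpace ℂ (Fin d₁))
    (w : EuclideanSpace ℂ (Fin d₂) ⊗[ℂ] EuclideanSpace ℂ (Fin d₃)) :
    innerC (cellState c) (x ⊗ₜ[ℂ] w) =
      x c.1 * innerC ((EuclideanSpace.single c.2.1 (1 : ℂ)) ⊗ₜ[ℂ]
        (EuclideanSpace.single c.2.2 (1 : ℂ))) w := by
  rw [cellState, innerC_tmul, EuclideanSpace.inner_single_left]
  simp

theorem inner_single_tmul (j : Fin d₂) (c : Fin d₃) (y : EuclideanSpace ℂ (Fin d₂))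
    (z : EuclideanSpace ℂ (Fin d₃)) :
    innerC ((EuclideanSpace.single j (1 : ℂ)) ⊗ₜ[ℂ] (EuclideanSpace.single c (1 : ℂ)))
      (y ⊗ₜ[ℂ] z) = y j * z c := by
  rw [innerC_tmul, EuclideanSpace.inner_single_left, EuclideanSpace.inner_single_left]
  simp

theorem inner_cellState_tileState_zero (c : Fin d₁ × Fin d₂ × Fin d₃) (t : Subcube d₁ d₂ d₃) :
    innerC (cellState c) (tileState t (0, 0, 0)) = if c ∈ cells t then 1 else 0 := by
  rw [tileState, inner_cellState_tmul, inner_single_tmul]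
  simp only [fourierState_zero_apply, mem_cells]
  by_cases h1 : c.1 ∈ t.1 <;> by_cases h2 : c.2.1 ∈ t.2.1 <;> by_cases h3 : c.2.2 ∈ t.2.2 <;>
    simp [h1, h2, h3]

theorem stopper_eq_sum : stopper d₁ d₂ d₃ = ∑ c, cellState c := by
  have h : ∀ d : ℕ, (WithLp.toLp 2 fun _ => 1 : EuclideanSpace ℂ (Fin d)) =
      ∑ i, EuclideanSpace.single i (1 : ℂ) := by
    intro d; ext j; simp
  simp only [stopper, h, cellState]
  exact sum_tmul_sum_tmul_sum _ _ _ _ _ _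

/-- A state orthogonal to the product states of a tile has constant amplitude on it. -/
theorem inner_cellState_of_orthogonal {t : Subcube d₁ d₂ d₃} {ψ : TripartiteSpace d₁ d₂ d₃}
    (hψ : ∀ φ ∈ tileStates t, innerC φ ψ = 0) {c : Fin d₁ × Fin d₂ × Fin d₃}
    (hc : c ∈ cells t) :
    ((cells t).card : ℂ) * innerC (cellState c) ψ = innerC (tileState t (0, 0, 0)) ψ := by
  have hzero := zero_mem_tileIndex ⟨c, hc⟩
  rw [mem_cells] at hc
  have hexp : ((cells t).card : ℂ) • cellState c = ∑ k ∈ tileIndex t,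
      (starRingEnd ℂ (omegaRoot t.1.card ^ (k.1 * rankIn t.1 c.1)) *
        (starRingEnd ℂ (omegaRoot t.2.1.card ^ (k.2.1 * rankIn t.2.1 c.2.1)) *
        starRingEnd ℂ (omegaRoot t.2.2.card ^ (k.2.2 * rankIn t.2.2 c.2.2)))) •
          tileState t k := by
    have hcard : ((cells t).card : ℂ) = (t.1.card : ℂ) * ((t.2.1.card : ℂ) * t.2.2.card) := by
      simp [cells]
    rw [hcard, cellState, ← TensorProduct.smul_tmul_smul, ← TensorProduct.smul_tmul_smul,
      card_smul_single hc.1, card_smul_single hc.2.1, card_smul_single hc.2.2,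
      sum_tmul_sum_tmul_sum]
    simp only [TensorProduct.smul_tmul_smul, tileState, tileIndex]
  refine natCast_mul_inner_eq_of_smul_eq_sum hexp hzero (by simp) fun k hk hne => hψ _ ?_
  rw [tileStates_eq]
  exact ⟨k, Finset.mem_coe.2 (Finset.mem_erase.2 ⟨hne, hk⟩), rfl⟩

theorem inner_cellState_congr {t : Subcube d₁ d₂ d₃} {ψ : TripartiteSpace d₁ d₂ d₃}
    (hψ : ∀ φ ∈ tileStates t, innerC φ ψ = 0) {c c' : Fin d₁ × Fin d₂ × Fin d₃}
    (hc : c ∈ cells t) (hc' : c' ∈ cells t) :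
    innerC (cellState c) ψ = innerC (cellState c') ψ := by
  have hne : ((cells t).card : ℂ) ≠ 0 := by
    exact_mod_cast (Finset.card_pos.2 ⟨c, hc⟩).ne'
  exact mul_left_cancel₀ hne ((inner_cellState_of_orthogonal hψ hc).trans
    (inner_cellState_of_orthogonal hψ hc').symm)

theorem mem_complementary {H : Type*} [NormedAddCommGroup H] [InnerProductSpace ℂ H] {S : Set H}
    {ψ : H} : ψ ∈ complementary S ↔ ∀ φ ∈ S, innerC φ ψ = 0 := by
  rw [complementary, Submodule.mem_orthogonal]
  refine ⟨fun h φ hφ => h φ (Submodule.subset_span hφ), fun h φ hφ => ?_⟩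
  induction hφ using Submodule.span_induction with
  | mem φ hφ => exact h φ hφ
  | zero => simp
  | add a b _ _ ha hb => rw [inner_add_left, ha, hb, add_zero]
  | smul r a _ ha => rw [inner_smul_left, ha, mul_zero]

/-- This splits membership into a local condition on each tile and one global linear condition, the
form in which the combinatorial arguments use it. -/
theorem mem_complementary_tileProductSet {T : Finset (Subcube d₁ d₂ d₃)}
    {ψ : TripartiteSpace d₁ d₂ d₃} :
    ψ ∈ complementary (tileProductSet T) ↔
      (∀ t ∈ T, ∀ φ ∈ tileStates t, innerC φ ψ = 0) ∧ ∑ c, innerC (cellState c) ψ = 0 := by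
  rw [mem_complementary, ← sum_inner, ← stopper_eq_sum]
  constructor
  · intro h
    exact ⟨fun t ht φ hφ => h φ (Or.inl (Set.mem_biUnion ht hφ)), h _ (Or.inr rfl)⟩
  · rintro ⟨h1, h2⟩ φ (hφ | rfl)
    · obtain ⟨t, ht, hφ⟩ := Set.mem_iUnion₂.1 hφ
      exact h1 t ht φ hφ
    · exact h2

variable {T : Finset (Subcube d₁ d₂ d₃)}

theorem IsTileStructure.inner_tileState_eq_zero (hT : IsTileStructure T)
    {s t : Subcube d₁ d₂ d₃} (hs : s ∈ T) (ht : t ∈ T) {k l : ℕ × ℕ × ℕ} (hk : k ∈ tileIndex s)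
    (hl : l ∈ tileIndex t) (hne : (s, k) ≠ (t, l)) :
    innerC (tileState s k) (tileState t l) = 0 := by
  by_cases hst : s = t
  · subst hst
    rw [inner_tileState s hk hl, if_neg]
    rintro rfl
    exact hne rfl
  · exact inner_tileState_of_disjoint (hT.2.1 s hs t ht hst) k l

/-- Weighted differences of the uniform states of two tiles lie in the complementary subspace. -/
theorem IsTileStructure.sub_mem_complementary (hT : IsTileStructure T) {s t : Subcube d₁ d₂ d₃}
    (hs : s ∈ T) (ht : t ∈ T) :
    ((cells t).card : ℂ) • tileState s (0, 0, 0) - ((cells s).card : ℂ) • tileState t (0, 0, 0) ∈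
      complementary (tileProductSet T) := by
  have hs0 := zero_mem_tileIndex (hT.1 s hs)
  have ht0 := zero_mem_tileIndex (hT.1 t ht)
  rw [mem_complementary_tileProductSet, ← sum_inner, ← stopper_eq_sum]
  constructor
  · intro r hr φ hφ
    rw [tileStates_eq] at hφ
    obtain ⟨k, hk, rfl⟩ := hφ
    obtain ⟨hk0, hk⟩ := Finset.mem_erase.1 (Finset.mem_coe.1 hk)
    refine (inner_smul_sub_smul (H := TripartiteSpace d₁ d₂ d₃) _ _ _ _ _).trans ?_
    rw [hT.inner_tileState_eq_zero hr hs hk hs0 (fun h => hk0 (Prod.mk.inj h).2),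
      hT.inner_tileState_eq_zero hr ht hk ht0 (fun h => hk0 (Prod.mk.inj h).2)]
    simp
  · refine (inner_smul_sub_smul (H := TripartiteSpace d₁ d₂ d₃) _ _ _ _ _).trans ?_
    rw [inner_stopper s hs0,
      inner_stopper t ht0, if_pos rfl, if_pos rfl, mul_comm, sub_self]

theorem IsTileStructure.inner_cellState_sub (hT : IsTileStructure T) {s t : Subcube d₁ d₂ d₃}
    (hs : s ∈ T) (ht : t ∈ T) (hst : s ≠ t) {c : Fin d₁ × Fin d₂ × Fin d₃} (hc : c ∈ cells s) :
    innerC (cellState c)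
      (((cells t).card : ℂ) • tileState s (0, 0, 0) -
        ((cells s).card : ℂ) • tileState t (0, 0, 0)) ≠ 0 := by
  have hct : c ∉ cells t := Finset.disjoint_left.1 (hT.2.1 s hs t ht hst) hc
  refine (inner_smul_sub_smul (H := TripartiteSpace d₁ d₂ d₃) _ _ _ _ _).trans_ne ?_
  rw [inner_cellState_tileState_zero, inner_cellState_tileState_zero, if_pos hc, if_neg hct, mul_one, mul_zero, sub_zero]
  exact_mod_cast (Finset.card_pos.2 (hT.1 t ht)).ne'

theorem IsTileStructure.mutuallyOrthogonal (hT : IsTileStructure T) :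
    MutuallyOrthogonal (tileProductSet T) := by
  have hsym : ∀ t ∈ T, ∀ φ ∈ tileStates t, innerC (stopper d₁ d₂ d₃) φ = 0 := by
    intro t _ φ hφ
    rw [tileStates_eq] at hφ
    obtain ⟨k, hk, rfl⟩ := hφ
    obtain ⟨hk0, hk⟩ := Finset.mem_erase.1 (Finset.mem_coe.1 hk)
    rw [inner_stopper t hk, if_neg hk0]
  rintro φ (hφ | rfl) χ (hχ | rfl) hne
  · obtain ⟨s, hs, hφ⟩ := Set.mem_iUnion₂.1 hφ
    obtain ⟨t, ht, hχ⟩ := Set.mem_iUnion₂.1 hχ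
    rw [tileStates_eq] at hφ hχ
    obtain ⟨k, hk, rfl⟩ := hφ
    obtain ⟨l, hl, rfl⟩ := hχ
    refine hT.inner_tileState_eq_zero hs ht (Finset.mem_of_mem_erase hk)
      (Finset.mem_of_mem_erase hl) ?_
    rintro h
    obtain ⟨rfl, rfl⟩ := Prod.mk.inj h
    exact hne rfl
  · obtain ⟨s, hs, hφ⟩ := Set.mem_iUnion₂.1 hφ
    exact inner_eq_zero_symm.1 (hsym s hs φ hφ)
  · obtain ⟨t, ht, hχ⟩ := Set.mem_iUnion₂.1 hχ
    exact hsym t ht χ hχ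
  · exact absurd rfl hne

theorem IsTileStructure.sum_card_cells (hT : IsTileStructure T) :
    ∑ t ∈ T, (cells t).card = d₁ * d₂ * d₃ := by
  rw [← Finset.card_biUnion hT.2.1]
  have : T.biUnion cells = Finset.univ := by
    ext c
    simpa using hT.2.2 c
  rw [this]
  simp [mul_assoc]

/-- Orthogonality of nonzero states makes distinct labels give distinct states. A tile `t`
contributes `|cells t| - 1` of them and the stopper one more; the count is written additively to
avoid truncated subtraction. -/
theorem IsTileStructure.tileProductSet_finite_ncard (hT : IsTileStructure T) :
    (tileProductSet T).Finite ∧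
      (tileProductSet T).ncard + T.card = d₁ * d₂ * d₃ + 1 := by
  let I : Finset (Σ _ : Subcube d₁ d₂ d₃, ℕ × ℕ × ℕ) :=
    T.sigma fun t => (tileIndex t).erase (0, 0, 0)
  let f : (Σ _ : Subcube d₁ d₂ d₃, ℕ × ℕ × ℕ) → TripartiteSpace d₁ d₂ d₃ :=
    fun p => tileState p.1 p.2
  have hImg : (⋃ t ∈ T, tileStates t) = f '' I := by
    ext ψ
    simp only [tileStates_eq, Set.mem_iUnion, Set.mem_image, Finset.mem_coe, exists_prop, I, f,
      Finset.mem_sigma, Sigma.exists]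
    constructor
    · rintro ⟨t, ht, k, hk, rfl⟩
      exact ⟨t, k, ⟨ht, hk⟩, rfl⟩
    · rintro ⟨t, k, ⟨ht, hk⟩, rfl⟩
      exact ⟨t, ht, k, hk, rfl⟩
  have hinj : Set.InjOn f I := by
    rintro ⟨s, k⟩ hs ⟨t, l⟩ ht h
    obtain ⟨hs, hk⟩ := Finset.mem_sigma.1 (Finset.mem_coe.1 hs)
    obtain ⟨ht, hl⟩ := Finset.mem_sigma.1 (Finset.mem_coe.1 ht)
    have hk := Finset.mem_of_mem_erase hk
    have hl := Finset.mem_of_mem_erase hl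
    by_contra hne
    have h0 := hT.inner_tileState_eq_zero hs ht hk hl (fun h => hne (by
      obtain ⟨h1, h2⟩ := Prod.mk.inj h
      exact Sigma.ext h1 (heq_of_eq h2)))
    change tileState s k = tileState t l at h
    dsimp only at h0
    rw [← h, inner_tileState s hk hk, if_pos rfl] at h0
    exact (Finset.card_pos.2 (hT.1 s hs)).ne' (by exact_mod_cast h0)
  have hnotMem : stopper d₁ d₂ d₃ ∉ ⋃ t ∈ T, tileStates t := by
    intro h
    obtain ⟨t, ht, h⟩ := Set.mem_iUnion₂.1 h
    rw [tileStates_eq] at h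
    obtain ⟨k, hk, h⟩ := h
    obtain ⟨hk0, hk⟩ := Finset.mem_erase.1 (Finset.mem_coe.1 hk)
    have h0 := inner_stopper t hk
    rw [← h, inner_tileState t hk hk, if_pos rfl, if_neg hk0] at h0
    exact (Finset.card_pos.2 (hT.1 t ht)).ne' (by exact_mod_cast h0)
  have hfin : (⋃ t ∈ T, tileStates t).Finite := hImg ▸ I.finite_toSet.image f
  refine ⟨hfin.union (Set.finite_singleton _), ?_⟩
  rw [tileProductSet, Set.union_singleton, Set.ncard_insert_of_notMem hnotMem hfin, hImg,
    hinj.ncard_image, Set.ncard_coe_finset, Finset.card_sigma,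
    ← hT.sum_card_cells, add_right_comm, Finset.card_eq_sum_ones T, ← Finset.sum_add_distrib]
  congr 1
  refine Finset.sum_congr rfl fun t ht => ?_
  rw [Finset.card_erase_of_mem (zero_mem_tileIndex (hT.1 t ht)), card_tileIndex]
  exact Nat.sub_add_cancel (Finset.card_pos.2 (hT.1 t ht))

theorem fourierState_ne_zero {d : ℕ} {R : Finset (Fin d)} {k : ℕ} (hk : k < R.card) :
    fourierState R k ≠ 0 := by
  intro h
  have := inner_fourierState R hk hk
  rw [h, inner_zero_left, if_pos rfl] at this
  exact absurd this.symm (by exact_mod_cast (show R.card ≠ 0 by omega))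

theorem tileProductSet_subset (h₁ : 0 < d₁) (h₂ : 0 < d₂) (h₃ : 0 < d₃) :
    tileProductSet T ⊆ productStates₃ (EuclideanSpace ℂ (Fin d₁)) (EuclideanSpace ℂ (Fin d₂))
      (EuclideanSpace ℂ (Fin d₃)) := by
  rintro ψ (hψ | rfl)
  · obtain ⟨t, -, k, l, m, hk, hl, hm, -, rfl⟩ := Set.mem_iUnion₂.1 hψ
    exact ⟨_, _, _, fourierState_ne_zero hk, fourierState_ne_zero hl, fourierState_ne_zero hm, rfl⟩
  · rw [stopper_eq]
    exact ⟨_, _, _, fourierState_ne_zero (by simpa using h₁), fourierState_ne_zero (by simpa using h₂),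
      fourierState_ne_zero (by simpa using h₃), rfl⟩

end TileStates

/-! ### A criterion for uncompletability in all local extensions -/

theorem span_ne_top_of_mem_complementary {H : Type*} [NormedAddCommGroup H]
    [InnerProductSpace ℂ H] {S : Set H} {ψ : H} (hψ : ψ ∈ complementary S) (h0 : ψ ≠ 0) :
    Submodule.span ℂ S ≠ ⊤ := by
  intro h
  rw [complementary, h, Submodule.top_orthogonal_eq_bot] at hψ
  exact h0 hψ

section Criterion

variable {E F : Type*} [NormedAddCommGroup E] [InnerProductSpace ℂ E] [FiniteDimensional ℂ E]
  [NormedAddCommGroup F] [InnerProductSpace ℂ F] [FiniteDimensional ℂ F]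

/-- If the product states in the complementary subspace of `S` lie in a proper subspace of it, then
`S` is uncompletable in every local extension. -/
theorem fewOrthogonalProducts_of_functional {S : Set (E ⊗[ℂ] F)} (L : E ⊗[ℂ] F →ₗ[ℂ] ℂ)
    (hL : ∀ x y, x ⊗ₜ[ℂ] y ∈ complementary S → L (x ⊗ₜ[ℂ] y) = 0)
    {u : E ⊗[ℂ] F} (hu : u ∈ complementary S) (hLu : L u ≠ 0)
    {E' F' : Type*} [NormedAddCommGroup E'] [InnerProductSpace ℂ E'] [FiniteDimensional ℂ E']
    [NormedAddCommGroup F'] [InnerProductSpace ℂ F'] [FiniteDimensional ℂ F']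
    (f : E →ₗᵢ[ℂ] E') (g : F →ₗᵢ[ℂ] F') :
    FewOrthogonalProducts (productStates₂ E' F')
      (TensorProduct.map f.toLinearMap g.toLinearMap '' S) := by
  intro T hTP hTS hTo
  by_contra hcard
  push Not at hcard
  set V := TensorProduct.map f.toLinearMap g.toLinearMap with hV
  have hne : ∀ ψ ∈ T, ψ ≠ 0 := by
    intro ψ hψ h0
    obtain ⟨x, y, hx, hy, rfl⟩ := hTP hψ
    have hn := congrArg norm h0
    rw [TensorProduct.norm_tmul, norm_zero, mul_eq_zero, norm_eq_zero, norm_eq_zero] at hn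
    exact hn.elim hx hy
  have hli : LinearIndependent ℂ (fun ψ : T => (ψ : E' ⊗[ℂ] F')) :=
    linearIndependent_of_ne_zero_of_inner_eq_zero (fun ψ => hne ψ ψ.2) fun φ χ hφχ =>
      hTo φ.2 χ.2 fun h => hφχ (Subtype.ext h)
  -- Orthogonal nonzero vectors are independent, so having at least as many as the dimension they
  -- span the whole complementary subspace.
  have hspan : Submodule.span ℂ (T : Set (E' ⊗[ℂ] F')) = complementary (V '' S) := by
    refine Submodule.eq_of_le_of_finrank_le (Submodule.span_le.2 hTS) ?_
    rwa [finrank_span_finset_eq_card hli]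
  have hVu : V u ∈ complementary (V '' S) := by
    rw [mem_complementary] at hu ⊢
    rintro _ ⟨φ, hφ, rfl⟩
    rw [hV, TensorProduct.inner_map_map]
    exact hu φ hφ
  -- The adjoint takes product vectors to product vectors and the extended complementary subspace
  -- into the original one. It may kill a factor, which is why `hL` must cover zero vectors.
  let W := TensorProduct.map f.toLinearMap.adjoint g.toLinearMap.adjoint
  have hW : ∀ a b, innerC a (W b) = innerC (V a) b := by
    intro a b
    rw [← LinearMap.adjoint_inner_right, hV, TensorProduct.adjoint_map]
  have hWV : W (V u) = u := by
    refine ext_inner_left ℂ fun a => ?_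
    rw [hW, hV, TensorProduct.inner_map_map]
  have hzero : ∀ ψ ∈ Submodule.span ℂ (T : Set (E' ⊗[ℂ] F')), L (W ψ) = 0 := by
    intro ψ hψ
    induction hψ using Submodule.span_induction with
    | mem ψ hψ =>
      have hc := mem_complementary.1 (hTS ψ hψ)
      obtain ⟨x, y, -, -, rfl⟩ := hTP hψ
      have hm : W (x ⊗ₜ[ℂ] y) ∈ complementary S :=
        mem_complementary.2 fun φ hφ => by rw [hW]; exact hc _ ⟨φ, hφ, rfl⟩
      rw [TensorProduct.map_tmul] at hm ⊢
      exact hL _ _ hm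
    | zero => simp
    | add a b _ _ ha hb => rw [map_add, map_add, ha, hb, add_zero]
    | smul r a _ ha => rw [map_smul, map_smul, ha, smul_zero]
  refine hLu ?_
  rw [← hWV]
  exact hzero _ (hspan ▸ hVu)

end Criterion

/-! ### Pinwheel combinatorics on the integer grid -/

/-- In centred coordinates, `j` belongs to the range of the line tile with signed index `a`. -/
def InLine (a j : ℤ) : Prop := (a ≤ j ∧ j ≤ -a - 1) ∨ (1 - a ≤ j ∧ j ≤ a)

/-- The orientation of the pinwheels in the two planes. -/
def planeSign (c : Fin 2) : ℤ := if c = 0 then 1 else -1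

theorem planeSign_eq (c : Fin 2) : planeSign c = 1 ∨ planeSign c = -1 := by
  unfold planeSign; split_ifs <;> simp

theorem planeSign_one_sub (c : Fin 2) : planeSign (1 - c) = -planeSign c := by
  fin_cases c <;> simp [planeSign]

theorem eq_one_sub_of_ne {c c' : Fin 2} (h : c' ≠ c) : c' = 1 - c := by omega

/-- Together with `not_inLine_and`: off the centre, each cell lies on exactly one of the row segment
and the column segment attached to it. -/
theorem inLine_or {s i j : ℤ} (hs : s = 1 ∨ s = -1) (h : i ≠ 0 ∨ j ≠ 0) :
    InLine (s * i) j ∨ InLine (-s * j) i := by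
  unfold InLine
  rcases hs with rfl | rfl <;> omega

theorem not_inLine_and {s i j : ℤ} (hs : s = 1 ∨ s = -1) :
    ¬ (InLine (s * i) j ∧ InLine (-s * j) i) := by
  unfold InLine
  rcases hs with rfl | rfl <;> omega

theorem inLine_self {a : ℤ} (h : a ≠ 0) : InLine a a := by unfold InLine; omega

theorem inLine_zero {a : ℤ} (h : a ≠ 0) : InLine a 0 := by unfold InLine; omega

theorem not_inLine_zero (j : ℤ) : ¬ InLine 0 j := by unfold InLine; omega

/-- Mutual membership forces `|a| = |b|`, and the segment of `a` omits `-a`. -/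
theorem inLine_antisymm {a b : ℤ} (h : InLine a b) (h' : InLine b a) : a = b := by
  unfold InLine at h h'; omega

/-- Each of the two segments misses one endpoint of `[-q, q]`, and they miss opposite ones. -/
theorem inLine_or_neg {a q j : ℤ} (ha : a = q ∨ a = -q) (hq : 1 ≤ q) (h : -q ≤ j) (h' : j ≤ q) :
    InLine a j ∨ InLine (-a) j := by
  unfold InLine; omega

/-- A function on the centred cells that is constant on the tiles of the layered structure. -/
structure PinwheelConstant (M : ℤ → ℤ → Fin 2 → ℂ) : Prop where
  row : ∀ c i j, InLine (planeSign c * i) j → M i j c = M i 0 c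
  col : ∀ c i j, InLine (-planeSign c * j) i → M i j c = M 0 j c
  centre : ∀ c c', M 0 0 c = M 0 0 c'

/-- Reflection in the diagonal turns rows into columns and reverses the pinwheels; exchanging the
planes restores the orientation. -/
theorem PinwheelConstant.swap {M : ℤ → ℤ → Fin 2 → ℂ} (h : PinwheelConstant M) :
    PinwheelConstant fun i j c => M j i (1 - c) where
  row c i j hij := h.col (1 - c) j i (by rwa [planeSign_one_sub, neg_neg])
  col c i j hij := h.row (1 - c) j i (by rwa [planeSign_one_sub])
  centre c c' := h.centre _ _

/-- The frame of radius `q` around the centre is where `x` and `w` take their central value. -/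
theorem PinwheelConstant.exists_frame {x : ℤ → ℂ} {w : ℤ → Fin 2 → ℂ}
    (h : PinwheelConstant fun i j c => x i * w j c) {m : ℕ}
    (hx : ∀ i, x i ≠ 0 → -(m : ℤ) ≤ i ∧ i ≤ m) (hw : ∀ j c, w j c ≠ 0 → -(m : ℤ) ≤ j ∧ j ≤ m)
    (h0 : x 0 * w 0 0 ≠ 0) :
    ∃ q : ℕ, (∀ i, x i = if -(q : ℤ) ≤ i ∧ i ≤ q then x 0 else 0) ∧
      ∀ i c, w i c = if -(q : ℤ) ≤ i ∧ i ≤ q then w 0 0 else 0 := by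
  classical
  have hx0 := left_ne_zero_of_mul h0
  have hw0 := right_ne_zero_of_mul h0
  have hwc : ∀ c, w 0 c = w 0 0 := fun c => mul_left_cancel₀ hx0 (h.centre c 0)
  have hrow : ∀ i, x i ≠ 0 → ∀ c j, InLine (planeSign c * i) j → w j c = w 0 0 := by
    intro i hi c j hij
    rw [mul_left_cancel₀ hi (h.row c i j hij), hwc]
  have hcol : ∀ j c, w j c ≠ 0 → ∀ i, InLine (-planeSign c * j) i → x i = x 0 := by
    intro j c hj i hij
    exact mul_right_cancel₀ hj (h.col c i j hij)
  -- The frame radius is the least `q` outside which both factors vanish; minimality will produce a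
  -- nonzero value at distance exactly `q`.
  have hex : ∃ q : ℕ, ∀ i : ℤ, ¬ (-(q : ℤ) ≤ i ∧ i ≤ q) → x i = 0 ∧ ∀ c, w i c = 0 := by
    refine ⟨m, fun i hi => ⟨?_, fun c => ?_⟩⟩
    · by_contra hne; exact hi (hx i hne)
    · by_contra hne; exact hi (hw i c hne)
  have hout := Nat.find_spec hex
  have hmin := fun n => Nat.find_min hex (m := n)
  generalize Nat.find hex = q at hout hmin
  suffices hin : ∀ i : ℤ, -(q : ℤ) ≤ i → i ≤ q → x i = x 0 ∧ ∀ c, w i c = w 0 0 by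
    refine ⟨q, fun i => ?_, fun i c => ?_⟩
    · split_ifs with hi
      · exact (hin i hi.1 hi.2).1
      · exact (hout i hi).1
    · split_ifs with hi
      · exact (hin i hi.1 hi.2).2 c
      · exact (hout i hi).2 c
  rcases Nat.eq_zero_or_pos q with rfl | hq
  · intro i hi hi'
    obtain rfl : i = 0 := by push_cast at hi hi'; omega
    exact ⟨rfl, hwc⟩
  have hq' : (1 : ℤ) ≤ q := by exact_mod_cast hq
  -- In plane 0 the row segment at `e` reaches column `e`, so `w e 0` is nonzero; the column segment
  -- there covers `[-q, q]` except `e`. In particular it reaches `-e`, which lets `hall` repeat the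
  -- argument from the opposite side.
  have hcross : ∀ e : ℤ, (e = q ∨ e = -q) → x e ≠ 0 → ∀ i, InLine (-e) i → x i = x 0 := by
    intro e he hxe i hi
    have he0 : planeSign 0 * e ≠ 0 := by simp [planeSign]; omega
    have h1 := hrow e hxe 0 _ (inLine_self he0)
    refine hcol (planeSign 0 * e) 0 (by rw [h1]; exact hw0) i ?_
    simpa [planeSign] using hi
  have hall : ∀ e : ℤ, (e = q ∨ e = -q) → x e ≠ 0 →
      ∀ i : ℤ, -(q : ℤ) ≤ i → i ≤ q → x i = x 0 ∧ ∀ c, w i c = w 0 0 := by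
    intro e he hxe i hi hi'
    have hne : x (-e) ≠ 0 := by
      rw [hcross e he hxe (-e) (inLine_self (by omega))]; exact hx0
    refine ⟨?_, fun c => ?_⟩
    · rcases inLine_or_neg he hq' hi hi' with hl | hl
      · exact hcross (-e) (by omega) hne i (by rwa [neg_neg])
      · exact hcross e he hxe i hl
    · have hs : planeSign c * e = q ∨ planeSign c * e = -q := by
        rcases planeSign_eq c with h1 | h1 <;> rw [h1] <;> omega
      rcases inLine_or_neg hs hq' hi hi' with hl | hl
      · exact hrow e hxe c i hl
      · exact hrow (-e) hne c i (by rwa [mul_neg])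
  have htouch : ∃ e : ℤ, (e = q ∨ e = -q) ∧ (x e ≠ 0 ∨ ∃ c, w e c ≠ 0) := by
    by_contra hno
    push Not at hno
    refine hmin (q - 1) (by omega) fun i hi => ?_
    by_cases hiq : i = q ∨ i = -q
    · exact hno i hiq
    · exact hout i (by omega)
  obtain ⟨e, he, hxe | ⟨c, hwe⟩⟩ := htouch
  · exact hall e he hxe
  -- A border value of `w` is carried along its column segment to a border value of `x`, which
  -- reduces this case to the previous one.
  · have hne : -planeSign c * e ≠ 0 := by
      rcases planeSign_eq c with h1 | h1 <;> rw [h1] <;> omega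
    refine hall (-planeSign c * e) ?_ ?_
    · rcases planeSign_eq c with h1 | h1 <;> rw [h1] <;> omega
    · rw [hcol e c hwe _ (inLine_self hne)]; exact hx0

/-- If `x` vanishes at the centre, then all nonzero cells lie in one row tile. -/
theorem PinwheelConstant.row_of_centre_eq_zero {x y : ℤ → ℂ} {z : Fin 2 → ℂ}
    (h : PinwheelConstant fun i j c => x i * (y j * z c)) (h0 : x 0 = 0)
    {i i' j j' : ℤ} {c c' : Fin 2} (hne : x i * (y j * z c) ≠ 0)
    (hne' : x i' * (y j' * z c') ≠ 0) :
    i = i' ∧ c = c' ∧ InLine (planeSign c * i) j ∧ InLine (planeSign c * i) j' := by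
  -- A column segment crosses the axis where `x` vanishes, so the product is zero on all of it.
  have hcol : ∀ c i j, x i ≠ 0 → y j ≠ 0 → z c ≠ 0 → ¬ InLine (-planeSign c * j) i := by
    intro c i j hi hj hc hl
    have := h.col c i j hl
    simp [h0, hi, hj, hc] at this
  have hrow : ∀ c i j, x i ≠ 0 → y j ≠ 0 → z c ≠ 0 → InLine (planeSign c * i) j := by
    intro c i j hi hj hc
    refine (inLine_or (planeSign_eq c) (Or.inl ?_)).resolve_right (hcol c i j hi hj hc)
    rintro rfl
    exact hi h0
  have hfull : ∀ c i j k, x i ≠ 0 → y j ≠ 0 → z c ≠ 0 → InLine (planeSign c * i) k → y k ≠ 0 := by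
    intro c i j k hi hj hc hk hy
    have h1 := h.row c i j (hrow c i j hi hj hc)
    have h2 := h.row c i k hk
    simp only [hy, zero_mul, mul_zero] at h2
    simp [← h2, hi, hj, hc] at h1
  have hself : ∀ c i, x i ≠ 0 → InLine (planeSign c * i) (planeSign c * i) := by
    intro c i hi
    refine inLine_self ?_
    have : i ≠ 0 := by rintro rfl; exact hi h0
    rcases planeSign_eq c with h1 | h1 <;> rw [h1] <;> omega
  simp only [ne_eq, mul_eq_zero, not_or] at hne hne'
  obtain ⟨hi, hj, hc⟩ := hne
  obtain ⟨hi', hj', hc'⟩ := hne'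
  -- The row segment makes `y` nonzero at `planeSign c * i`. In the other plane, where the
  -- orientation is opposite, the cell of row `i` over that position lies on a column segment.
  obtain rfl : c' = c := by
    by_contra hcc
    obtain rfl := eq_one_sub_of_ne hcc
    refine hcol (1 - c) i (planeSign c * i) hi (hfull c i j _ hi hj hc (hself c i hi)) hc' ?_
    have hi0 : i ≠ 0 := by rintro rfl; exact hi h0
    rw [planeSign_one_sub]
    rcases planeSign_eq c with h1 | h1 <;> rw [h1] <;> simpa using inLine_self hi0
  refine ⟨?_, rfl, hrow _ _ _ hi hj hc, hrow _ _ _ hi hj' hc⟩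
  -- Both rows share the factor `y`, so the extreme point of each segment must lie on the other one.
  have h1 := hrow _ i (planeSign c' * i') hi (hfull _ i' j _ hi' hj hc (hself _ i' hi')) hc
  have h2 := hrow _ i' (planeSign c' * i) hi' (hfull _ i j _ hi hj hc (hself _ i hi)) hc
  have h3 := inLine_antisymm h1 h2
  rcases planeSign_eq c' with h4 | h4 <;> rw [h4] at h3 <;> omega

/-! ### The layered tiling in centred coordinates -/

section Layered

variable {m : ℕ}

/-- The coordinate of an index relative to the centre. -/
def centred {m : ℕ} (i : Fin (2 * m + 1)) : ℤ := (i : ℤ) - m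

theorem centred_injective : Function.Injective (centred (m := m)) := by
  intro i j h
  unfold centred at h
  exact Fin.ext (by omega)

theorem centred_mem (i : Fin (2 * m + 1)) : -(m : ℤ) ≤ centred i ∧ centred i ≤ m := by
  unfold centred
  have := i.isLt
  omega

theorem exists_centred_eq {a : ℤ} (h : -(m : ℤ) ≤ a ∧ a ≤ m) :
    ∃ i : Fin (2 * m + 1), centred i = a :=
  ⟨⟨(a + m).toNat, by omega⟩, by unfold centred; simp only; omega⟩

open Classical in
/-- The row tile through the cell `(i, m, c)`. -/
noncomputable def rowTile (c : Fin 2) (i : Fin (2 * m + 1)) : Subcube (2 * m + 1) (2 * m + 1) 2 :=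
  ({i}, Finset.univ.filter fun j => InLine (planeSign c * centred i) (centred j), {c})

open Classical in
/-- The column tile through the cell `(m, j, c)`. -/
noncomputable def colTile (c : Fin 2) (j : Fin (2 * m + 1)) : Subcube (2 * m + 1) (2 * m + 1) 2 :=
  (Finset.univ.filter fun i => InLine (-planeSign c * centred j) (centred i), {j}, {c})

/-- The middle index. -/
def middle (m : ℕ) : Fin (2 * m + 1) := ⟨m, by omega⟩

theorem centred_middle : centred (middle m) = 0 := by simp [centred, middle]

theorem centred_eq_zero {i : Fin (2 * m + 1)} : centred i = 0 ↔ i = middle m := by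
  rw [← centred_middle, centred_injective.eq_iff]

/-- The centre tile. -/
def centreTile (m : ℕ) : Subcube (2 * m + 1) (2 * m + 1) 2 :=
  ({middle m}, {middle m}, Finset.univ)

theorem mem_rowTile {c c' : Fin 2} {i i' j : Fin (2 * m + 1)} :
    (i', j, c') ∈ cells (rowTile c i) ↔
      i' = i ∧ c' = c ∧ InLine (planeSign c * centred i) (centred j) := by
  simp only [mem_cells, rowTile, Finset.mem_singleton, Finset.mem_filter, Finset.mem_univ,
    true_and]
  tauto

theorem mem_colTile {c c' : Fin 2} {i j j' : Fin (2 * m + 1)} :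
    (i, j', c') ∈ cells (colTile c j) ↔
      j' = j ∧ c' = c ∧ InLine (-planeSign c * centred j) (centred i) := by
  simp only [mem_cells, colTile, Finset.mem_singleton, Finset.mem_filter, Finset.mem_univ,
    true_and]
  tauto

theorem mem_centreTile {c : Fin 2} {i j : Fin (2 * m + 1)} :
    (i, j, c) ∈ cells (centreTile m) ↔ i = middle m ∧ j = middle m := by
  simp [mem_cells, centreTile]

theorem indexPoint_eq (i : Fin (2 * m + 1)) {n : ℕ} (h : (n : ℤ) = centred i + m) :
    indexPoint (2 * m + 1) n = {i} := by
  ext j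
  simp only [indexPoint, Finset.mem_filter, Finset.mem_univ, true_and, Finset.mem_singleton,
    Fin.ext_iff]
  unfold centred at h
  omega

open Classical in
theorem indexRange_eq {a : ℤ} {p q : ℕ}
    (h : ∀ j : ℕ, (p ≤ j ∧ j ≤ q) ↔ InLine a (j - m)) :
    indexRange (2 * m + 1) p q = Finset.univ.filter fun j => InLine a (centred j) := by
  ext j
  simp only [indexRange, Finset.mem_filter, Finset.mem_univ, true_and]
  exact h j

theorem rowTile_eq {c : Fin 2} (i : Fin (2 * m + 1)) {n p q : ℕ} (hn : (n : ℤ) = centred i + m)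
    (h : ∀ j : ℕ, (p ≤ j ∧ j ≤ q) ↔ InLine (planeSign c * centred i) (j - m)) :
    (indexPoint (2 * m + 1) n, indexRange (2 * m + 1) p q, ({c} : Finset (Fin 2))) =
      rowTile c i := by
  rw [indexPoint_eq i hn, indexRange_eq h, rowTile]

theorem colTile_eq {c : Fin 2} (i : Fin (2 * m + 1)) {n p q : ℕ} (hn : (n : ℤ) = centred i + m)
    (h : ∀ j : ℕ, (p ≤ j ∧ j ≤ q) ↔ InLine (-planeSign c * centred i) (j - m)) :
    (indexRange (2 * m + 1) p q, indexPoint (2 * m + 1) n, ({c} : Finset (Fin 2))) =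
      colTile c i := by
  rw [indexPoint_eq i hn, indexRange_eq h, colTile]

theorem planeSign_zero : planeSign 0 = 1 := rfl
theorem planeSign_one : planeSign 1 = -1 := rfl

/-- The tiles of layer `k`, in terms of the two indices at distance `m - k + 1` from the centre. -/
theorem layerTiles_eq {k : ℕ} (h1 : 1 ≤ k) (hk : k ≤ m) {i i' : Fin (2 * m + 1)}
    (hi : centred i = k - 1 - m) (hi' : centred i' = m + 1 - k) :
    layerTiles (2 * m + 1) k =
      {rowTile 0 i, colTile 0 i', rowTile 0 i', colTile 0 i,
        colTile 1 i, rowTile 1 i, colTile 1 i', rowTile 1 i'} := by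
  rw [layerTiles, rowTile_eq (c := 0) i, colTile_eq (c := 0) i', rowTile_eq (c := 0) i',
    colTile_eq (c := 0) i, colTile_eq (c := 1) i, rowTile_eq (c := 1) i, colTile_eq (c := 1) i',
    rowTile_eq (c := 1) i']
  all_goals
    simp only [hi, hi', planeSign_zero, planeSign_one, InLine]
    omega

/-- This removes the layer index: for each plane, every index other than the middle one carries one
row tile and one column tile. -/
theorem mem_layeredTiles {t : Subcube (2 * m + 1) (2 * m + 1) 2} :
    t ∈ layeredTiles (2 * m + 1) ↔
      (∃ c i, i ≠ middle m ∧ t = rowTile c i) ∨ (∃ c j, j ≠ middle m ∧ t = colTile c j) ∨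
        t = centreTile m := by
  have hcentre : (indexPoint (2 * m + 1) ((2 * m + 1 - 1) / 2),
      indexPoint (2 * m + 1) ((2 * m + 1 - 1) / 2), (Finset.univ : Finset (Fin 2))) =
        centreTile m := by
    rw [indexPoint_eq (middle m) (by rw [centred_middle]; omega), centreTile]
  have hm : (2 * m + 1 - 1) / 2 = m := by omega
  rw [layeredTiles, hcentre, hm, Finset.mem_union, Finset.mem_singleton, Finset.mem_biUnion,
    ← or_assoc]
  refine or_congr_left ⟨?_, ?_⟩
  · rintro ⟨k, hk, ht⟩
    rw [Finset.mem_Icc] at hk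
    obtain ⟨i, hi⟩ := exists_centred_eq (m := m) (a := k - 1 - m) (by omega)
    obtain ⟨i', hi'⟩ := exists_centred_eq (m := m) (a := m + 1 - k) (by omega)
    have hne : i ≠ middle m := fun h => by rw [← centred_eq_zero] at h; omega
    have hne' : i' ≠ middle m := fun h => by rw [← centred_eq_zero] at h; omega
    rw [layerTiles_eq hk.1 hk.2 hi hi'] at ht
    simp only [Finset.mem_insert, Finset.mem_singleton] at ht
    rcases ht with h | h | h | h | h | h | h | h
    · exact Or.inl ⟨_, _, hne, h⟩
    · exact Or.inr ⟨_, _, hne', h⟩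
    · exact Or.inl ⟨_, _, hne', h⟩
    · exact Or.inr ⟨_, _, hne, h⟩
    · exact Or.inr ⟨_, _, hne, h⟩
    · exact Or.inl ⟨_, _, hne, h⟩
    · exact Or.inr ⟨_, _, hne', h⟩
    · exact Or.inl ⟨_, _, hne', h⟩
  · have key : ∀ i : Fin (2 * m + 1), i ≠ middle m → ∀ c, ∃ k ∈ Finset.Icc 1 m,
        rowTile c i ∈ layerTiles (2 * m + 1) k ∧ colTile c i ∈ layerTiles (2 * m + 1) k := by
      intro i hi c
      rw [ne_eq, ← centred_eq_zero] at hi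
      have hb := centred_mem i
      obtain ⟨i', hi'⟩ := exists_centred_eq (m := m) (a := -centred i) (by omega)
      -- The layer number solves `centred i = k - 1 - m` on the negative side and `centred i = m + 1
      -- - k` on the positive side.
      rcases lt_or_gt_of_ne hi with hlt | hgt
      · refine ⟨(centred i + m + 1).toNat, Finset.mem_Icc.2 (by omega), ?_⟩
        rw [layerTiles_eq (i := i) (i' := i') (by omega) (by omega) (by omega) (by omega)]
        fin_cases c <;> simp
      · refine ⟨(m + 1 - centred i).toNat, Finset.mem_Icc.2 (by omega), ?_⟩
        rw [layerTiles_eq (i := i') (i' := i) (by omega) (by omega) (by omega) (by omega)]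
        fin_cases c <;> simp
    rintro (⟨c, i, hi, rfl⟩ | ⟨c, i, hi, rfl⟩)
    · obtain ⟨k, hk, h, -⟩ := key i hi c
      exact ⟨k, hk, h⟩
    · obtain ⟨k, hk, -, h⟩ := key i hi c
      exact ⟨k, hk, h⟩

theorem rowTile_mem {c : Fin 2} {i : Fin (2 * m + 1)} (hi : i ≠ middle m) :
    rowTile c i ∈ layeredTiles (2 * m + 1) :=
  mem_layeredTiles.2 (Or.inl ⟨c, i, hi, rfl⟩)

theorem colTile_mem {c : Fin 2} {j : Fin (2 * m + 1)} (hj : j ≠ middle m) :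
    colTile c j ∈ layeredTiles (2 * m + 1) :=
  mem_layeredTiles.2 (Or.inr (Or.inl ⟨c, j, hj, rfl⟩))

theorem centreTile_mem : centreTile m ∈ layeredTiles (2 * m + 1) :=
  mem_layeredTiles.2 (Or.inr (Or.inr rfl))

theorem planeSign_mul_centred_ne_zero {c : Fin 2} {i : Fin (2 * m + 1)} (hi : i ≠ middle m) :
    planeSign c * centred i ≠ 0 ∧ -planeSign c * centred i ≠ 0 := by
  rw [ne_eq, ← centred_eq_zero] at hi
  rcases planeSign_eq c with h | h <;> rw [h] <;> omega

theorem middle_mem_rowTile {c : Fin 2} {i : Fin (2 * m + 1)} (hi : i ≠ middle m) :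
    (i, middle m, c) ∈ cells (rowTile c i) :=
  mem_rowTile.2 ⟨rfl, rfl, by
    rw [centred_middle]; exact inLine_zero (planeSign_mul_centred_ne_zero hi).1⟩

theorem middle_mem_colTile {c : Fin 2} {j : Fin (2 * m + 1)} (hj : j ≠ middle m) :
    (middle m, j, c) ∈ cells (colTile c j) :=
  mem_colTile.2 ⟨rfl, rfl, by
    rw [centred_middle]; exact inLine_zero (planeSign_mul_centred_ne_zero hj).2⟩

theorem layeredTiles_eq_of_mem {s t : Subcube (2 * m + 1) (2 * m + 1) 2}
    (hs : s ∈ layeredTiles (2 * m + 1)) (ht : t ∈ layeredTiles (2 * m + 1))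
    {e : Fin (2 * m + 1) × Fin (2 * m + 1) × Fin 2} (hes : e ∈ cells s) (het : e ∈ cells t) :
    s = t := by
  obtain ⟨i, j, c⟩ := e
  have hrc : ∀ {c' c'' i' j'}, (i, j, c) ∈ cells (rowTile c' i') →
      (i, j, c) ∈ cells (colTile c'' j') → False := by
    intro c' c'' i' j' h h'
    obtain ⟨rfl, rfl, h⟩ := mem_rowTile.1 h
    obtain ⟨rfl, rfl, h'⟩ := mem_colTile.1 h'
    exact not_inLine_and (planeSign_eq _) ⟨h, h'⟩
  have hr0 : ∀ {c' i'}, (i, j, c) ∈ cells (rowTile c' i') →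
      (i, j, c) ∈ cells (centreTile m) → False := by
    intro c' i' h h'
    obtain ⟨rfl, rfl, h⟩ := mem_rowTile.1 h
    rw [(mem_centreTile.1 h').1, centred_middle, mul_zero] at h
    exact not_inLine_zero _ h
  have hc0 : ∀ {c' j'}, (i, j, c) ∈ cells (colTile c' j') →
      (i, j, c) ∈ cells (centreTile m) → False := by
    intro c' j' h h'
    obtain ⟨rfl, rfl, h⟩ := mem_colTile.1 h
    rw [(mem_centreTile.1 h').2, centred_middle, mul_zero] at h
    exact not_inLine_zero _ h
  rcases mem_layeredTiles.1 hs with ⟨c', i', -, rfl⟩ | ⟨c', i', -, rfl⟩ | rfl <;>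
    rcases mem_layeredTiles.1 ht with ⟨c'', j', -, rfl⟩ | ⟨c'', j', -, rfl⟩ | rfl
  · obtain ⟨rfl, rfl, -⟩ := mem_rowTile.1 hes
    obtain ⟨rfl, rfl, -⟩ := mem_rowTile.1 het
    rfl
  · exact (hrc hes het).elim
  · exact (hr0 hes het).elim
  · exact (hrc het hes).elim
  · obtain ⟨rfl, rfl, -⟩ := mem_colTile.1 hes
    obtain ⟨rfl, rfl, -⟩ := mem_colTile.1 het
    rfl
  · exact (hc0 hes het).elim
  · exact (hr0 het hes).elim
  · exact (hc0 het hes).elim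
  · rfl

theorem exists_rowTile_or_colTile {i j : Fin (2 * m + 1)} (h : i ≠ middle m ∨ j ≠ middle m)
    (c : Fin 2) : (i ≠ middle m ∧ (i, j, c) ∈ cells (rowTile c i)) ∨
      (j ≠ middle m ∧ (i, j, c) ∈ cells (colTile c j)) := by
  simp only [ne_eq, ← centred_eq_zero] at h ⊢
  rcases inLine_or (planeSign_eq c) h with hl | hl
  · refine Or.inl ⟨fun h0 => ?_, mem_rowTile.2 ⟨rfl, rfl, hl⟩⟩
    rw [h0, mul_zero] at hl
    exact not_inLine_zero _ hl
  · refine Or.inr ⟨fun h0 => ?_, mem_colTile.2 ⟨rfl, rfl, hl⟩⟩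
    rw [h0, mul_zero] at hl
    exact not_inLine_zero _ hl

theorem isTileStructure_layeredTiles (m : ℕ) : IsTileStructure (layeredTiles (2 * m + 1)) := by
  refine ⟨?_, ?_, ?_⟩
  · intro t ht
    rcases mem_layeredTiles.1 ht with ⟨c, i, hi, rfl⟩ | ⟨c, i, hi, rfl⟩ | rfl
    · exact ⟨_, middle_mem_rowTile hi⟩
    · exact ⟨_, middle_mem_colTile hi⟩
    · exact ⟨(middle m, middle m, 0), mem_centreTile.2 ⟨rfl, rfl⟩⟩
  · intro s hs t ht hst
    rw [Finset.disjoint_left]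
    exact fun e hes het => hst (layeredTiles_eq_of_mem hs ht hes het)
  · rintro ⟨i, j, c⟩
    by_cases h : i ≠ middle m ∨ j ≠ middle m
    · rcases exists_rowTile_or_colTile h c with ⟨hi, h⟩ | ⟨hj, h⟩
      · exact ⟨_, rowTile_mem hi, h⟩
      · exact ⟨_, colTile_mem hj, h⟩
    · push Not at h
      exact ⟨_, centreTile_mem, mem_centreTile.2 h⟩

/-- A row or column tile is recovered from the cell where it crosses an axis. Two planes, two
directions and `2 * m` indices give `8 * m`, and the centre tile adds one. -/
theorem card_layeredTiles (m : ℕ) : (layeredTiles (2 * m + 1)).card = 8 * m + 1 := by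
  classical
  let X : Finset (Fin 2 × Fin (2 * m + 1)) := Finset.univ ×ˢ Finset.univ.erase (middle m)
  have hX : ∀ {c i}, (c, i) ∈ X ↔ i ≠ middle m := by simp [X]
  have hXcard : X.card = 4 * m := by
    simp only [X, Finset.card_product, Finset.card_univ, Fintype.card_fin,
      Finset.card_erase_of_mem (Finset.mem_univ _)]
    omega
  have hT : layeredTiles (2 * m + 1) =
      insert (centreTile m) (X.image (fun p => rowTile p.1 p.2) ∪
        X.image (fun p => colTile p.1 p.2)) := by
    ext t
    simp only [mem_layeredTiles, Finset.mem_insert, Finset.mem_union, Finset.mem_image,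
      Prod.exists, hX, @eq_comm _ t]
    rw [← or_assoc, or_comm]
  have hdisj : ∀ {c i c' j}, (i : Fin (2 * m + 1)) ≠ middle m → j ≠ middle m →
      rowTile c i ≠ colTile c' j := by
    intro c i c' j hi hj h
    have h1 := middle_mem_rowTile (c := c) hi
    rw [h] at h1
    exact hj (mem_colTile.1 h1).1.symm
  rw [hT, Finset.card_insert_of_notMem, Finset.card_union_of_disjoint,
    Finset.card_image_of_injOn, Finset.card_image_of_injOn, hXcard]
  · omega
  · rintro ⟨c, i⟩ hi ⟨c', j⟩ hj h
    have h1 := middle_mem_colTile (c := c) (hX.1 (Finset.mem_coe.1 hi))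
    dsimp only at h
    rw [h] at h1
    obtain ⟨rfl, rfl, -⟩ := mem_colTile.1 h1
    rfl
  · rintro ⟨c, i⟩ hi ⟨c', j⟩ hj h
    have h1 := middle_mem_rowTile (c := c) (hX.1 (Finset.mem_coe.1 hi))
    dsimp only at h
    rw [h] at h1
    obtain ⟨rfl, rfl, -⟩ := mem_rowTile.1 h1
    rfl
  · rw [Finset.disjoint_left]
    intro t ht ht'
    obtain ⟨⟨c, i⟩, hi, rfl⟩ := Finset.mem_image.1 ht
    obtain ⟨⟨c', j⟩, hj, h⟩ := Finset.mem_image.1 ht'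
    exact hdisj (hX.1 hi) (hX.1 hj) h.symm
  · intro ht
    rcases Finset.mem_union.1 ht with ht | ht
    · obtain ⟨⟨c, i⟩, hi, h⟩ := Finset.mem_image.1 ht
      have h1 := middle_mem_rowTile (c := c) (hX.1 hi)
      dsimp only at h
      rw [h] at h1
      exact hX.1 hi (mem_centreTile.1 h1).1
    · obtain ⟨⟨c, i⟩, hi, h⟩ := Finset.mem_image.1 ht
      have h1 := middle_mem_colTile (c := c) (hX.1 hi)
      dsimp only at h
      rw [h] at h1
      exact hX.1 hi (mem_centreTile.1 h1).2

end Layered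

/-! ### Tile-constant product functions and special cubes -/

section Amplitudes

variable {m : ℕ}

open Classical in
/-- Extension by zero of a function of the index to the centred integer coordinate. -/
noncomputable def extendCentred {α : Type*} [Zero α] (f : Fin (2 * m + 1) → α) (a : ℤ) : α :=
  if h : ∃ i : Fin (2 * m + 1), centred i = a then f h.choose else 0

theorem extendCentred_centred {α : Type*} [Zero α] (f : Fin (2 * m + 1) → α)
    (i : Fin (2 * m + 1)) : extendCentred f (centred i) = f i := by
  have h : ∃ j : Fin (2 * m + 1), centred j = centred i := ⟨i, rfl⟩
  rw [extendCentred, dif_pos h, centred_injective h.choose_spec]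

theorem extendCentred_of_not {α : Type*} [Zero α] (f : Fin (2 * m + 1) → α) {a : ℤ}
    (h : ¬ ∃ i : Fin (2 * m + 1), centred i = a) : extendCentred f a = 0 := dif_neg h

theorem extendCentred_zero {α : Type*} [Zero α] (f : Fin (2 * m + 1) → α) :
    extendCentred f 0 = f (middle m) := by
  rw [← centred_middle, extendCentred_centred]

/-- The function `M` of the cells is constant on the tiles of the layered structure. -/
def ConstantOnTiles (M : Fin (2 * m + 1) × Fin (2 * m + 1) × Fin 2 → ℂ) : Prop :=
  ∀ t ∈ layeredTiles (2 * m + 1), ∀ e ∈ cells t, ∀ e' ∈ cells t, M e = M e'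

/-- Segments attached to indices of the grid stay inside the grid. For an index outside it, the zero
extension makes the equations trivial. -/
theorem ConstantOnTiles.pinwheelConstant {x : Fin (2 * m + 1) → ℂ}
    {w : Fin (2 * m + 1) → Fin 2 → ℂ}
    (h : ConstantOnTiles fun e => x e.1 * w e.2.1 e.2.2) :
    PinwheelConstant fun a b c => extendCentred x a * extendCentred w b c where
  row c a b hab := by
    by_cases ha : ∃ i : Fin (2 * m + 1), centred i = a
    · obtain ⟨i, rfl⟩ := ha
      have hi : i ≠ middle m := by
        rintro rfl
        rw [centred_middle, mul_zero] at hab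
        exact not_inLine_zero _ hab
      obtain ⟨j, rfl⟩ : ∃ j : Fin (2 * m + 1), centred j = b := by
        refine exists_centred_eq ?_
        have := centred_mem i
        unfold InLine at hab
        rcases planeSign_eq c with h1 | h1 <;> rw [h1] at hab <;> omega
      simp only [extendCentred_zero, extendCentred_centred]
      exact h _ (rowTile_mem hi) (i, j, c) (mem_rowTile.2 ⟨rfl, rfl, hab⟩) (i, middle m, c)
        (middle_mem_rowTile hi)
    · simp [extendCentred_of_not x ha]
  col c a b hab := by
    by_cases hb : ∃ j : Fin (2 * m + 1), centred j = b
    · obtain ⟨j, rfl⟩ := hb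
      have hj : j ≠ middle m := by
        rintro rfl
        rw [centred_middle, mul_zero] at hab
        exact not_inLine_zero _ hab
      obtain ⟨i, rfl⟩ : ∃ i : Fin (2 * m + 1), centred i = a := by
        refine exists_centred_eq ?_
        have := centred_mem j
        unfold InLine at hab
        rcases planeSign_eq c with h1 | h1 <;> rw [h1] at hab <;> omega
      simp only [extendCentred_zero, extendCentred_centred]
      exact h _ (colTile_mem hj) (i, j, c) (mem_colTile.2 ⟨rfl, rfl, hab⟩) (middle m, j, c)
        (middle_mem_colTile hj)
    · simp [extendCentred_of_not w hb]
  centre c c' := by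
    simp only [extendCentred_zero]
    exact h _ centreTile_mem (middle m, middle m, c) (mem_centreTile.2 ⟨rfl, rfl⟩)
      (middle m, middle m, c') (mem_centreTile.2 ⟨rfl, rfl⟩)

theorem exists_of_extendCentred_ne_zero {α : Type*} [Zero α] {f : Fin (2 * m + 1) → α} {a : ℤ}
    (h : extendCentred f a ≠ 0) : -(m : ℤ) ≤ a ∧ a ≤ m := by
  by_cases ha : ∃ i : Fin (2 * m + 1), centred i = a
  · obtain ⟨i, rfl⟩ := ha
    exact centred_mem i
  · exact absurd (extendCentred_of_not f ha) h

/-- A bipartite pinwheel-constant product function with centre value nonzero is a nonzero constant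
on a frame and vanishes elsewhere. -/
theorem PinwheelConstant.sum_ne_zero {x : Fin (2 * m + 1) → ℂ} {w : Fin (2 * m + 1) → Fin 2 → ℂ}
    (h : PinwheelConstant fun a b c => extendCentred x a * extendCentred w b c)
    (h0 : x (middle m) * w (middle m) 0 ≠ 0) :
    (∑ i, x i) * ∑ j, ∑ c, w j c ≠ 0 := by
  obtain ⟨q, hx, hw⟩ := h.exists_frame (m := m) (fun i => exists_of_extendCentred_ne_zero)
    (fun j c hjc => exists_of_extendCentred_ne_zero (f := w) fun h => hjc (by rw [h]; rfl))
    (by rwa [extendCentred_zero, extendCentred_zero])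
  have hx' : ∀ i, x i = if -(q : ℤ) ≤ centred i ∧ centred i ≤ q then x (middle m) else 0 := by
    intro i; rw [← extendCentred_centred x i, hx, extendCentred_zero]
  have hw' : ∀ j c, w j c =
      if -(q : ℤ) ≤ centred j ∧ centred j ≤ q then w (middle m) 0 else 0 := by
    intro j c; rw [← extendCentred_centred w j, hw, extendCentred_zero]
  have hcard : ((Finset.univ.filter fun i : Fin (2 * m + 1) =>
      -(q : ℤ) ≤ centred i ∧ centred i ≤ q).card : ℂ) ≠ 0 := by
    have : 0 < (Finset.univ.filter fun i : Fin (2 * m + 1) =>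
      -(q : ℤ) ≤ centred i ∧ centred i ≤ q).card :=
        Finset.card_pos.2 ⟨middle m, by simp [centred_middle]⟩
    exact_mod_cast this.ne'
  have hsx : ∑ i, x i = ((Finset.univ.filter fun i : Fin (2 * m + 1) =>
      -(q : ℤ) ≤ centred i ∧ centred i ≤ q).card : ℂ) * x (middle m) := by
    rw [Finset.sum_congr rfl fun i _ => hx' i, ← Finset.sum_filter, Finset.sum_const, nsmul_eq_mul]
  have hsw : ∑ j, ∑ c, w j c = ((Finset.univ.filter fun i : Fin (2 * m + 1) =>
      -(q : ℤ) ≤ centred i ∧ centred i ≤ q).card : ℂ) * (2 * w (middle m) 0) := by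
    have h2 : ∀ j, ∑ c, w j c =
        if -(q : ℤ) ≤ centred j ∧ centred j ≤ q then 2 * w (middle m) 0 else 0 := by
      intro j
      rw [Fin.sum_univ_two, hw', hw' j 1]
      split_ifs <;> ring
    rw [Finset.sum_congr rfl fun j _ => h2 j, ← Finset.sum_filter, Finset.sum_const, nsmul_eq_mul]
  rw [hsx, hsw]
  exact mul_ne_zero (mul_ne_zero hcard (left_ne_zero_of_mul h0))
    (mul_ne_zero hcard (mul_ne_zero two_ne_zero (right_ne_zero_of_mul h0)))

/-- Otherwise the total sum would factor into two nonzero sums over a frame. -/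
theorem ConstantOnTiles.centre_eq_zero {x : Fin (2 * m + 1) → ℂ}
    {w : Fin (2 * m + 1) → Fin 2 → ℂ}
    (h : ConstantOnTiles fun e => x e.1 * w e.2.1 e.2.2)
    (hsum : ∑ e : Fin (2 * m + 1) × Fin (2 * m + 1) × Fin 2, x e.1 * w e.2.1 e.2.2 = 0) :
    x (middle m) * w (middle m) 0 = 0 := by
  by_contra h0
  refine h.pinwheelConstant.sum_ne_zero h0 ?_
  rw [← hsum, Finset.sum_mul, Fintype.sum_prod_type]
  simp only [Finset.mul_sum, Fintype.sum_prod_type]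

theorem ConstantOnTiles.centre_eq_zero_swap {y : Fin (2 * m + 1) → ℂ}
    {v : Fin 2 → Fin (2 * m + 1) → ℂ}
    (h : ConstantOnTiles fun e => y e.2.1 * v e.2.2 e.1)
    (hsum : ∑ e : Fin (2 * m + 1) × Fin (2 * m + 1) × Fin 2, y e.2.1 * v e.2.2 e.1 = 0) :
    y (middle m) * v 0 (middle m) = 0 := by
  by_contra h0
  -- After the exchange of planes the centre value is read in plane 1; the centre tile spans both
  -- planes.
  have h1 : y (middle m) * v 1 (middle m) = y (middle m) * v 0 (middle m) :=
    h _ centreTile_mem (middle m, middle m, 1) (mem_centreTile.2 ⟨rfl, rfl⟩)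
      (middle m, middle m, 0) (mem_centreTile.2 ⟨rfl, rfl⟩)
  -- With `B` as the single party the grid is transposed, so the planes are exchanged by `1 - c` to
  -- recover the pinwheel orientation.
  have hP : PinwheelConstant fun a b c =>
      extendCentred y a * extendCentred (fun i c => v (1 - c) i) b c := by
    have hext : ∀ b c, extendCentred (fun i c => v (1 - c) i) b c =
        extendCentred (fun i => v (1 - c) i) b := by
      intro b c
      by_cases hb : ∃ i : Fin (2 * m + 1), centred i = b
      · obtain ⟨i, rfl⟩ := hb
        simp only [extendCentred_centred]
      · rw [extendCentred_of_not _ hb, extendCentred_of_not _ hb]; rfl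
    refine ⟨fun c a b hab => ?_, fun c a b hab => ?_, fun c c' => ?_⟩
    · simp only [hext]
      by_cases ha : ∃ i : Fin (2 * m + 1), centred i = a
      · obtain ⟨j, rfl⟩ := ha
        have hj : j ≠ middle m := by
          rintro rfl
          rw [centred_middle, mul_zero] at hab
          exact not_inLine_zero _ hab
        obtain ⟨i, rfl⟩ : ∃ i : Fin (2 * m + 1), centred i = b := by
          refine exists_centred_eq ?_
          have := centred_mem j
          unfold InLine at hab
          rcases planeSign_eq c with h1 | h1 <;> rw [h1] at hab <;> omega
        simp only [extendCentred_zero, extendCentred_centred]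
        exact h _ (colTile_mem (c := 1 - c) hj) (i, j, 1 - c)
          (mem_colTile.2 ⟨rfl, rfl, by rwa [planeSign_one_sub, neg_neg]⟩) (middle m, j, 1 - c)
          (middle_mem_colTile hj)
      · simp [extendCentred_of_not y ha]
    · simp only [hext]
      by_cases hb : ∃ i : Fin (2 * m + 1), centred i = b
      · obtain ⟨i, rfl⟩ := hb
        have hi : i ≠ middle m := by
          rintro rfl
          rw [centred_middle, mul_zero] at hab
          exact not_inLine_zero _ hab
        obtain ⟨j, rfl⟩ : ∃ j : Fin (2 * m + 1), centred j = a := by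
          refine exists_centred_eq ?_
          have := centred_mem i
          unfold InLine at hab
          rcases planeSign_eq c with h1 | h1 <;> rw [h1] at hab <;> omega
        simp only [extendCentred_zero, extendCentred_centred]
        exact h _ (rowTile_mem (c := 1 - c) hi) (i, j, 1 - c)
          (mem_rowTile.2 ⟨rfl, rfl, by rwa [planeSign_one_sub]⟩) (i, middle m, 1 - c)
          (middle_mem_rowTile hi)
      · simp [extendCentred_of_not (fun i => v (1 - c) i) hb]
    · simp only [extendCentred_zero]
      exact h _ centreTile_mem (middle m, middle m, 1 - c) (mem_centreTile.2 ⟨rfl, rfl⟩)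
        (middle m, middle m, 1 - c') (mem_centreTile.2 ⟨rfl, rfl⟩)
  refine hP.sum_ne_zero (by simpa [h1] using h0) ?_
  have hrev : ∀ i, ∑ c : Fin 2, v (1 - c) i = ∑ c : Fin 2, v c i := by
    intro i
    simp [Fin.sum_univ_two, add_comm]
  simp only [hrev]
  rw [← hsum, mul_comm, Finset.sum_mul, Fintype.sum_prod_type]
  refine Finset.sum_congr rfl fun i _ => ?_
  rw [Fintype.sum_prod_type, Finset.mul_sum]
  refine Finset.sum_congr rfl fun j _ => ?_
  rw [mul_comm, Finset.mul_sum]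

/-- A tripartite product function that is constant on the tiles and vanishes at the centre is
supported in one tile. -/
theorem ConstantOnTiles.exists_tile {x y : Fin (2 * m + 1) → ℂ} {z : Fin 2 → ℂ}
    (h : ConstantOnTiles fun e => x e.1 * (y e.2.1 * z e.2.2))
    (h0 : x (middle m) * (y (middle m) * z 0) = 0)
    {e e' : Fin (2 * m + 1) × Fin (2 * m + 1) × Fin 2}
    (he : x e.1 * (y e.2.1 * z e.2.2) ≠ 0) (he' : x e'.1 * (y e'.2.1 * z e'.2.2) ≠ 0) :
    ∃ t ∈ layeredTiles (2 * m + 1), e ∈ cells t ∧ e' ∈ cells t := by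
  obtain ⟨i, j, c⟩ := e
  obtain ⟨i', j', c'⟩ := e'
  dsimp only at he he'
  have hext : ∀ b c, extendCentred (fun j c => y j * z c) b c = extendCentred y b * z c := by
    intro b c
    by_cases hb : ∃ i : Fin (2 * m + 1), centred i = b
    · obtain ⟨i, rfl⟩ := hb
      simp only [extendCentred_centred]
    · rw [extendCentred_of_not _ hb, extendCentred_of_not _ hb, zero_mul]; rfl
  have hP := ConstantOnTiles.pinwheelConstant (w := fun j c => y j * z c) h
  simp only [hext] at hP
  have hxy : x (middle m) = 0 ∨ y (middle m) = 0 := by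
    have hc : x (middle m) * (y (middle m) * z c) = 0 := by
      rw [← h0]
      exact h _ centreTile_mem (middle m, middle m, c) (mem_centreTile.2 ⟨rfl, rfl⟩)
        (middle m, middle m, 0) (mem_centreTile.2 ⟨rfl, rfl⟩)
    have hz : z c ≠ 0 := right_ne_zero_of_mul (right_ne_zero_of_mul he)
    simpa [hz] using hc
  rw [← extendCentred_centred x, ← extendCentred_centred y] at he he'
  rcases hxy with hx | hy
  · obtain ⟨h1, rfl, h2, h3⟩ := hP.row_of_centre_eq_zero (by rw [extendCentred_zero, hx]) he he'
    obtain rfl := centred_injective h1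
    refine ⟨_, rowTile_mem (c := c) (i := i) ?_, mem_rowTile.2 ⟨rfl, rfl, h2⟩,
      mem_rowTile.2 ⟨rfl, rfl, h3⟩⟩
    rintro rfl
    rw [extendCentred_centred, hx, zero_mul] at he
    exact he rfl
  -- If instead `y` vanishes at the centre, the reflected function satisfies the row statement,
  -- which yields a column tile.
  · have hP' : PinwheelConstant fun a b c =>
        extendCentred y a * (extendCentred x b * z (1 - c)) := by
      simpa only [mul_left_comm] using hP.swap
    have hcc : ∀ c : Fin 2, 1 - (1 - c) = c := fun c => by omega
    obtain ⟨h1, h4, h2, h3⟩ := hP'.row_of_centre_eq_zero (c := 1 - c) (c' := 1 - c')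
      (by rw [extendCentred_zero, hy]) (by rwa [hcc, mul_left_comm]) (by rwa [hcc, mul_left_comm])
    obtain rfl := centred_injective h1
    obtain rfl : c = c' := by rw [← hcc c, h4, hcc]
    rw [planeSign_one_sub] at h2 h3
    refine ⟨_, colTile_mem (c := c) (j := j) ?_, mem_colTile.2 ⟨rfl, rfl, h2⟩,
      mem_colTile.2 ⟨rfl, rfl, h3⟩⟩
    rintro rfl
    rw [extendCentred_centred y, hy, zero_mul, mul_zero] at he
    exact he rfl

/-- The indicator of a special cube is a tile-constant product function. If it vanished at the
centre its support would lie in one tile, but it contains two. -/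
theorem IsSpecialCube.middle_mem {C : Subcube (2 * m + 1) (2 * m + 1) 2}
    (hC : IsSpecialCube (layeredTiles (2 * m + 1)) C) (c : Fin 2) :
    (middle m, middle m, c) ∈ cells C := by
  classical
  obtain ⟨T', hT', hcard, hcells⟩ := hC
  have hT := isTileStructure_layeredTiles m
  have hclosed : ∀ t ∈ layeredTiles (2 * m + 1), ∀ e ∈ cells t, e ∈ cells C → cells t ⊆ cells C := by
    intro t ht e he heC
    rw [hcells] at heC ⊢
    obtain ⟨s, hs, hes⟩ := Finset.mem_biUnion.1 heC
    rw [layeredTiles_eq_of_mem ht (hT' hs) he hes]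
    exact Finset.subset_biUnion_of_mem cells hs
  suffices h0 : (middle m, middle m, 0) ∈ cells C from
    hclosed _ centreTile_mem _ (mem_centreTile.2 ⟨rfl, rfl⟩) h0 (mem_centreTile.2 ⟨rfl, rfl⟩)
  by_contra h0
  let x : Fin (2 * m + 1) → ℂ := fun i => if i ∈ C.1 then 1 else 0
  let y : Fin (2 * m + 1) → ℂ := fun j => if j ∈ C.2.1 then 1 else 0
  let z : Fin 2 → ℂ := fun c => if c ∈ C.2.2 then 1 else 0
  have hM : ∀ e : Fin (2 * m + 1) × Fin (2 * m + 1) × Fin 2,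
      x e.1 * (y e.2.1 * z e.2.2) = if e ∈ cells C then 1 else 0 := by
    intro e
    simp only [mem_cells, x, y, z]
    by_cases h1 : e.1 ∈ C.1 <;> by_cases h2 : e.2.1 ∈ C.2.1 <;> by_cases h3 : e.2.2 ∈ C.2.2 <;>
      simp [h1, h2, h3]
  have hconst : ConstantOnTiles fun e => x e.1 * (y e.2.1 * z e.2.2) := by
    intro t ht e he e' he'
    simp only [hM]
    have : e ∈ cells C ↔ e' ∈ cells C :=
      ⟨fun h => hclosed t ht e he h he', fun h => hclosed t ht e' he' h he⟩
    simp only [this]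
  obtain ⟨s, hs, t, ht, hst⟩ := Finset.one_lt_card.1 hcard
  obtain ⟨e, he⟩ := hT.1 s (hT' hs)
  obtain ⟨e', he'⟩ := hT.1 t (hT' ht)
  have heC : e ∈ cells C := by rw [hcells]; exact Finset.mem_biUnion.2 ⟨s, hs, he⟩
  have heC' : e' ∈ cells C := by rw [hcells]; exact Finset.mem_biUnion.2 ⟨t, ht, he'⟩
  obtain ⟨r, hr, her, her'⟩ := hconst.exists_tile ((hM (middle m, middle m, 0)).trans (if_neg h0))
    (e := e) (e' := e') (by rw [hM, if_pos heC]; exact one_ne_zero)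
    (by rw [hM, if_pos heC']; exact one_ne_zero)
  exact hst ((layeredTiles_eq_of_mem (hT' hs) hr he her).trans
    (layeredTiles_eq_of_mem (hT' ht) hr he' her').symm)

/-- The part that misses the centre cannot be a special cube, so it is a tile in a single plane. The
other part contains the centre in both planes, and being a box it is forced to meet that tile. -/
theorem isUTileStructure_layeredTiles (hm : 1 ≤ m) :
    IsUTileStructure (layeredTiles (2 * m + 1)) := by
  refine ⟨isTileStructure_layeredTiles m, by rw [card_layeredTiles]; omega, ?_⟩
  rintro C hC ⟨R, S, hR, hS, hdisj, hCRS⟩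
  have key : ∀ R S : Subcube (2 * m + 1) (2 * m + 1) 2,
      (IsSpecialCube (layeredTiles (2 * m + 1)) R ∨ R ∈ layeredTiles (2 * m + 1)) →
      (IsSpecialCube (layeredTiles (2 * m + 1)) S ∨ S ∈ layeredTiles (2 * m + 1)) →
      Disjoint (cells R) (cells S) → cells C = cells R ∪ cells S →
      (middle m, middle m, 0) ∉ cells R := by
    intro R S hR hS hdisj hCRS h0
    have hR1 : (middle m, middle m, 1) ∈ cells R := by
      rcases hR with hR | hR
      · exact hR.middle_mem 1
      · rw [layeredTiles_eq_of_mem hR centreTile_mem h0 (mem_centreTile.2 ⟨rfl, rfl⟩)]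
        exact mem_centreTile.2 ⟨rfl, rfl⟩
    have hS0 := Finset.disjoint_left.1 hdisj h0
    have hST := hS.resolve_left fun hS => hS0 (hS.middle_mem 0)
    have hSc : ∃ c, S.2.2 = {c} := by
      rcases mem_layeredTiles.1 hST with ⟨c, i, -, rfl⟩ | ⟨c, i, -, rfl⟩ | rfl
      · exact ⟨c, rfl⟩
      · exact ⟨c, rfl⟩
      · exact absurd (mem_centreTile.2 ⟨rfl, rfl⟩) hS0
    obtain ⟨c, hc⟩ := hSc
    obtain ⟨⟨i, j, c'⟩, he⟩ := (isTileStructure_layeredTiles m).1 S hST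
    have heS := mem_cells.1 he
    obtain rfl : c' = c := by simpa [hc] using heS.2.2
    have heC := mem_cells.1 (show (i, j, c') ∈ cells C by
      rw [hCRS]; exact Finset.mem_union_right _ he)
    -- The copy of the cell in the opposite plane lies in `C` but not in `S`, hence in `R`; then `R`
    -- contains the position `(i, j)` over both planes.
    have hother : (i, j, 1 - c') ∈ cells C :=
      mem_cells.2 ⟨heC.1, heC.2.1, (mem_cells.1 (hC.middle_mem (1 - c'))).2.2⟩
    rw [hCRS] at hother
    have hotherR := mem_cells.1 ((Finset.mem_union.1 hother).resolve_right fun h => by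
      have := (mem_cells.1 h).2.2
      rw [hc, Finset.mem_singleton] at this
      dsimp only at this
      omega)
    refine Finset.disjoint_left.1 hdisj
      ((mem_cells (c := (i, j, c'))).2 ⟨hotherR.1, hotherR.2.1, ?_⟩) he
    rcases (show c' = 0 ∨ c' = 1 by omega) with rfl | rfl
    · exact (mem_cells.1 h0).2.2
    · exact (mem_cells.1 hR1).2.2
  have hC0 := hC.middle_mem 0
  rw [hCRS] at hC0
  rcases Finset.mem_union.1 hC0 with h | h
  · exact key R S hR hS hdisj hCRS h
  · exact key S R hS hR hdisj.symm (by rw [hCRS, Finset.union_comm]) h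

end Amplitudes

/-! ### Identification of `U1` with the product set of the tiling -/

section ProductSet

theorem fourierState_indexPoint (d n : ℕ) : fourierState (indexPoint d n) 0 = ket d n := by
  ext j
  simp [fourierState_apply, indexPoint, ket]

theorem card_indexPoint {d n : ℕ} (h : n < d) : (indexPoint d n).card = 1 := by
  rw [Finset.card_eq_one]
  refine ⟨⟨n, h⟩, ?_⟩
  ext j
  simp [indexPoint, Fin.ext_iff]

theorem fourierState_singleton (c : Fin 2) :
    fourierState ({c} : Finset (Fin 2)) 0 = ket 2 c := by
  ext j
  simp [fourierState_apply, ket, Fin.ext_iff]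

theorem card_indexRange_filter {d a b n : ℕ} (h : b < d) (hn : b + 1 = a + n) :
    (indexRange d a b).card = n := by
  have : (indexRange d a b).map Fin.valEmbedding = Finset.Icc a b := by
    ext j
    simp only [indexRange, Finset.mem_map, Finset.mem_filter, Finset.mem_univ, true_and,
      Fin.valEmbedding_apply, Finset.mem_Icc]
    constructor
    · rintro ⟨i, hi, rfl⟩; exact hi
    · intro hj; exact ⟨⟨j, by omega⟩, hj, rfl⟩
  rw [← Finset.card_map Fin.valEmbedding, this, Nat.card_Icc]
  omega

theorem rankIn_indexRange {d a b : ℕ} {j : Fin d} (hj : j ∈ indexRange d a b) :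
    rankIn (indexRange d a b) j = j - a := by
  simp only [indexRange, Finset.mem_filter, Finset.mem_univ, true_and] at hj
  -- The case `j = 0` is separate because the truncated `j - 1` would wrongly keep the index 0.
  rcases Nat.eq_zero_or_pos (j : ℕ) with h0 | hpos
  · rw [h0, Nat.zero_sub, Finset.card_eq_zero, Finset.filter_eq_empty_iff]
    intro i _ hi
    rw [Fin.lt_def] at hi
    omega
  · have : (indexRange d a b).filter (· < j) = indexRange d a (j - 1) := by
      ext i
      simp only [indexRange, Finset.mem_filter, Finset.mem_univ, true_and, Fin.lt_def]
      omega
    rw [rankIn, this, card_indexRange_filter (n := j - a)] <;> omega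

theorem fourierState_indexRange {d a b n : ℕ} (h : b < d) (hn : b + 1 = a + n) (i : ℕ) :
    fourierState (indexRange d a b) i =
      ∑ s ∈ Finset.range n, omegaRoot n ^ (i * s) • ket d (a + s) := by
  ext j
  simp only [WithLp.ofLp_sum, Finset.sum_apply, PiLp.smul_apply, smul_eq_mul, ket, mul_ite, mul_one,
    mul_zero]
  rw [fourierState_apply, card_indexRange_filter h hn]
  split_ifs with hj
  · have hj' := hj
    simp only [indexRange, Finset.mem_filter, Finset.mem_univ, true_and] at hj'
    rw [Finset.sum_eq_single_of_mem (j - a : ℕ) (Finset.mem_range.2 (by omega)), if_pos (by omega),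
      rankIn_indexRange hj]
    intro s _ hs
    rw [if_neg (by omega)]
  · simp only [indexRange, Finset.mem_filter, Finset.mem_univ, true_and] at hj
    refine (Finset.sum_eq_zero fun s hs => ?_).symm
    rw [if_neg]
    rw [Finset.mem_range] at hs
    omega

theorem fourierState_alpha {d k : ℕ} (h1 : 1 ≤ k) (hk : 2 * k < d) (i : ℕ) :
    fourierState (indexRange d (k - 1) (d - k - 1)) i = alphaState d k i := by
  rw [fourierState_indexRange (n := d - 2 * k + 1) (by omega) (by omega), alphaState]
  refine Finset.sum_congr rfl fun s _ => ?_
  rw [show k - 1 + s = s + k - 1 by omega]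

theorem fourierState_beta {d k : ℕ} (h1 : 1 ≤ k) (hk : 2 * k < d) (i : ℕ) :
    fourierState (indexRange d k (d - k)) i = betaState d k i := by
  rw [fourierState_indexRange (n := d - 2 * k + 1) (by omega) (by omega), betaState]
  refine Finset.sum_congr rfl fun s _ => ?_
  rw [show k + s = s + k by omega]

theorem mem_tileStates_row {d n : ℕ} (h : n < d) (R : Finset (Fin d)) (c : Fin 2)
    {ψ : TripartiteSpace d d 2} :
    ψ ∈ tileStates (indexPoint d n, R, {c}) ↔ ∃ i, (1 ≤ i ∧ i < R.card) ∧
      ψ = ket d n ⊗ₜ[ℂ] (fourierState R i ⊗ₜ[ℂ] ket 2 c) := by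
  simp only [tileStates, Set.mem_ofPred_eq, card_indexPoint h, Finset.card_singleton]
  constructor
  · rintro ⟨k, l, m, hk, hl, hm, hne, rfl⟩
    obtain rfl : k = 0 := by omega
    obtain rfl : m = 0 := by omega
    refine ⟨l, ⟨?_, hl⟩, by rw [fourierState_indexPoint, fourierState_singleton]⟩
    refine Nat.one_le_iff_ne_zero.2 ?_
    rintro rfl
    exact hne rfl
  · rintro ⟨i, ⟨h1, hi⟩, rfl⟩
    exact ⟨0, i, 0, one_pos, hi, one_pos, by simp; omega,
      by rw [fourierState_indexPoint, fourierState_singleton]⟩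

theorem mem_tileStates_col {d n : ℕ} (h : n < d) (R : Finset (Fin d)) (c : Fin 2)
    {ψ : TripartiteSpace d d 2} :
    ψ ∈ tileStates (R, indexPoint d n, {c}) ↔ ∃ i, (1 ≤ i ∧ i < R.card) ∧
      ψ = fourierState R i ⊗ₜ[ℂ] (ket d n ⊗ₜ[ℂ] ket 2 c) := by
  simp only [tileStates, Set.mem_ofPred_eq, card_indexPoint h, Finset.card_singleton]
  constructor
  · rintro ⟨k, l, m, hk, hl, hm, hne, rfl⟩
    obtain rfl : l = 0 := by omega
    obtain rfl : m = 0 := by omega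
    refine ⟨k, ⟨?_, hk⟩, by rw [fourierState_indexPoint, fourierState_singleton]⟩
    refine Nat.one_le_iff_ne_zero.2 ?_
    rintro rfl
    exact hne rfl
  · rintro ⟨i, ⟨h1, hi⟩, rfl⟩
    exact ⟨i, 0, 0, hi, one_pos, one_pos, by simp; omega,
      by rw [fourierState_indexPoint, fourierState_singleton]⟩

theorem fourierState_univ_two :
    fourierState (Finset.univ : Finset (Fin 2)) 1 = ket 2 0 - ket 2 1 := by
  have hω : omegaRoot 2 = -1 := by
    rw [omegaRoot, ← Complex.exp_pi_mul_I]
    congr 1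
    push_cast
    ring
  have h0 : rankIn (Finset.univ : Finset (Fin 2)) 0 = 0 := by decide
  have h1 : rankIn (Finset.univ : Finset (Fin 2)) 1 = 1 := by decide
  ext j
  rw [fourierState_apply, if_pos (Finset.mem_univ j), Finset.card_univ, Fintype.card_fin, hω,
    one_mul]
  rcases (show j = 0 ∨ j = 1 by omega) with rfl | rfl
  · rw [h0]
    simp [ket]
  · rw [h1]
    simp [ket]

theorem tileStates_centre {d n : ℕ} (h : n < d) :
    tileStates (indexPoint d n, indexPoint d n, (Finset.univ : Finset (Fin 2))) =
      {ket d n ⊗ₜ[ℂ] (ket d n ⊗ₜ[ℂ] (ket 2 0 - ket 2 1))} := by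
  ext ψ
  simp only [tileStates, Set.mem_ofPred_eq, card_indexPoint h, Finset.card_univ, Fintype.card_fin,
    Set.mem_singleton_iff]
  constructor
  · rintro ⟨k, l, m, hk, hl, hm, hne, rfl⟩
    obtain rfl : k = 0 := by omega
    obtain rfl : l = 0 := by omega
    obtain rfl : m = 1 := by
      have : m ≠ 0 := by rintro rfl; exact hne rfl
      omega
    rw [fourierState_indexPoint, fourierState_univ_two]
  · rintro rfl
    exact ⟨0, 0, 1, one_pos, one_pos, one_lt_two, by simp,
      by rw [fourierState_indexPoint, fourierState_univ_two]⟩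

/-- Only the long side of a tile, of length `d - 2 * k + 1`, has nonzero frequencies, and these are
`1, …, d - 2 * k`. -/
theorem biUnion_layerTiles {d k : ℕ} (h1 : 1 ≤ k) (hk : 2 * k < d) :
    ⋃ t ∈ layerTiles d k, tileStates t = layerStates d k := by
  ext ψ
  have hcα : (indexRange d (k - 1) (d - k - 1)).card = d - 2 * k + 1 :=
    card_indexRange_filter (by omega) (by omega)
  have hcβ : (indexRange d k (d - k)).card = d - 2 * k + 1 :=
    card_indexRange_filter (by omega) (by omega)
  have hk1 : k - 1 < d := by omega
  have hk2 : d - k < d := by omega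
  simp only [Set.mem_iUnion, exists_prop, layerTiles, Finset.mem_insert, Finset.mem_singleton,
    exists_eq_or_imp, exists_eq_left, mem_tileStates_row hk1, mem_tileStates_row hk2,
    mem_tileStates_col hk1, mem_tileStates_col hk2, hcα, hcβ, fourierState_alpha h1 hk,
    fourierState_beta h1 hk, Nat.lt_add_one_iff, layerStates, Set.mem_ofPred_eq, ← exists_or,
    ← and_or_left, and_assoc, Fin.val_zero, Fin.val_one]

theorem U1_eq_tileProductSet {d : ℕ} (hodd : Odd d) : U1 d = tileProductSet (layeredTiles d) := by
  have hlt : (d - 1) / 2 < d := by have := hodd.pos; omega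
  rw [U1, tileProductSet, layeredTiles]
  congr 1
  rw [Finset.set_biUnion_union, Finset.set_biUnion_singleton, tileStates_centre hlt, centreState,
    Finset.set_biUnion_biUnion]
  congr 1
  refine Set.iUnion₂_congr fun k hk => ?_
  rw [Finset.mem_Icc] at hk
  rw [biUnion_layerTiles hk.1 (by omega)]

end ProductSet

/-! ### Product states in the complementary subspace, and the theorem -/

section Main

variable {m : ℕ}

theorem constantOnTiles_of_mem_complementary {ψ : TripartiteSpace (2 * m + 1) (2 * m + 1) 2}
    (hψ : ψ ∈ complementary (tileProductSet (layeredTiles (2 * m + 1)))) :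
    ConstantOnTiles fun e => innerC (cellState e) ψ := fun t ht _ he _ he' =>
  inner_cellState_congr ((mem_complementary_tileProductSet.1 hψ).1 t ht) he he'

/-- No product state in the bipartition `A|BC` that lies in the complementary subspace has a
component at the centre. -/
theorem inner_centre_tmul_eq_zero (x : EuclideanSpace ℂ (Fin (2 * m + 1)))
    (w : EuclideanSpace ℂ (Fin (2 * m + 1)) ⊗[ℂ] EuclideanSpace ℂ (Fin 2))
    (h : x ⊗ₜ[ℂ] w ∈ complementary (tileProductSet (layeredTiles (2 * m + 1)))) :
    innerC (cellState (middle m, middle m, 0)) (x ⊗ₜ[ℂ] w) = 0 := by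
  have h1 := constantOnTiles_of_mem_complementary h
  have h2 := (mem_complementary_tileProductSet.1 h).2
  simp only [inner_cellState_tmul] at h1 h2 ⊢
  exact ConstantOnTiles.centre_eq_zero (x := x) (w := fun j c => innerC
    ((EuclideanSpace.single j (1 : ℂ)) ⊗ₜ[ℂ] (EuclideanSpace.single c (1 : ℂ))) w) h1 h2

theorem inner_rotateABC {E F G : Type*} [NormedAddCommGroup E] [InnerProductSpace ℂ E]
    [NormedAddCommGroup F] [InnerProductSpace ℂ F] [NormedAddCommGroup G] [InnerProductSpace ℂ G]
    (a b : E ⊗[ℂ] (F ⊗[ℂ] G)) : innerC (rotateABC a) (rotateABC b) = innerC a b :=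
  (TensorProduct.inner_assoc_assoc _ _).trans (TensorProduct.inner_comm_comm a b)

theorem rotateABC_mem_complementary {E F G : Type*} [NormedAddCommGroup E]
    [InnerProductSpace ℂ E] [NormedAddCommGroup F] [InnerProductSpace ℂ F]
    [NormedAddCommGroup G] [InnerProductSpace ℂ G] {S : Set (E ⊗[ℂ] (F ⊗[ℂ] G))}
    {ψ : E ⊗[ℂ] (F ⊗[ℂ] G)} :
    rotateABC ψ ∈ complementary (rotateABC '' S) ↔ ψ ∈ complementary S := by
  simp only [mem_complementary, Set.forall_mem_image, inner_rotateABC]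

/-- A rotated cell state is definitionally the cell state of the rotated cell. -/
theorem inner_rotateABC_cellState_tmul (e : Fin (2 * m + 1) × Fin (2 * m + 1) × Fin 2)
    (y : EuclideanSpace ℂ (Fin (2 * m + 1)))
    (v : EuclideanSpace ℂ (Fin 2) ⊗[ℂ] EuclideanSpace ℂ (Fin (2 * m + 1))) :
    innerC (rotateABC (cellState e)) (y ⊗ₜ[ℂ] v) =
      y e.2.1 * innerC ((EuclideanSpace.single e.2.2 (1 : ℂ)) ⊗ₜ[ℂ]
        (EuclideanSpace.single e.1 (1 : ℂ))) v :=
  inner_cellState_tmul (e.2.1, e.2.2, e.1) y v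

theorem inner_centre_rotateABC_tmul_eq_zero (y : EuclideanSpace ℂ (Fin (2 * m + 1)))
    (v : EuclideanSpace ℂ (Fin 2) ⊗[ℂ] EuclideanSpace ℂ (Fin (2 * m + 1)))
    (h : y ⊗ₜ[ℂ] v ∈
      complementary (rotateABC '' tileProductSet (layeredTiles (2 * m + 1)))) :
    innerC (rotateABC (cellState (middle m, middle m, 0))) (y ⊗ₜ[ℂ] v) = 0 := by
  obtain ⟨ψ, hψ⟩ := (rotateABC (E := EuclideanSpace ℂ (Fin (2 * m + 1)))).surjective (y ⊗ₜ[ℂ] v)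
  rw [← hψ, rotateABC_mem_complementary] at h
  have h1 := constantOnTiles_of_mem_complementary h
  have h2 := (mem_complementary_tileProductSet.1 h).2
  have hin : ∀ e, innerC (cellState e) ψ = y e.2.1 * innerC
      ((EuclideanSpace.single e.2.2 (1 : ℂ)) ⊗ₜ[ℂ] (EuclideanSpace.single e.1 (1 : ℂ))) v := by
    intro e
    rw [← inner_rotateABC_cellState_tmul, ← hψ, inner_rotateABC]
  simp only [hin] at h1 h2
  rw [inner_rotateABC_cellState_tmul]
  exact ConstantOnTiles.centre_eq_zero_swap (y := y) (v := fun c i => innerC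
    ((EuclideanSpace.single c (1 : ℂ)) ⊗ₜ[ℂ] (EuclideanSpace.single i (1 : ℂ))) v) h1 h2

/-- The centre amplitude vanishes by the bipartite result, so the support is one tile; a nonzero
constant on one tile cannot sum to zero. -/
theorem product_notMem_complementary {ψ : TripartiteSpace (2 * m + 1) (2 * m + 1) 2}
    (hψ : ψ ∈ productStates₃ (EuclideanSpace ℂ (Fin (2 * m + 1)))
      (EuclideanSpace ℂ (Fin (2 * m + 1))) (EuclideanSpace ℂ (Fin 2))) :
    ψ ∉ complementary (tileProductSet (layeredTiles (2 * m + 1))) := by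
  classical
  obtain ⟨x, y, z, hx, hy, hz, rfl⟩ := hψ
  intro h
  have h0 := inner_centre_tmul_eq_zero _ _ h
  have h1 := constantOnTiles_of_mem_complementary h
  have h2 := (mem_complementary_tileProductSet.1 h).2
  simp only [inner_cellState_tmul, inner_single_tmul] at h0 h1 h2
  have hex : ∀ {d : ℕ} {u : EuclideanSpace ℂ (Fin d)}, u ≠ 0 → ∃ i, u i ≠ 0 := by
    intro d u hu
    by_contra hno
    push Not at hno
    exact hu (by ext i; exact hno i)
  obtain ⟨i, hi⟩ := hex hx
  obtain ⟨j, hj⟩ := hex hy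
  obtain ⟨c, hc⟩ := hex hz
  have hne : x i * (y j * z c) ≠ 0 := mul_ne_zero hi (mul_ne_zero hj hc)
  obtain ⟨t, ht, het⟩ := (isTileStructure_layeredTiles m).2.2 (i, j, c)
  have hval : ∀ e : Fin (2 * m + 1) × Fin (2 * m + 1) × Fin 2,
      x e.1 * (y e.2.1 * z e.2.2) = if e ∈ cells t then x i * (y j * z c) else 0 := by
    intro e
    split_ifs with he
    · exact h1 t ht e he (i, j, c) het
    · by_contra hne'
      obtain ⟨s, hs, hes, hes'⟩ := h1.exists_tile h0 (e := (i, j, c)) (e' := e) hne hne'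
      exact he (layeredTiles_eq_of_mem ht hs het hes ▸ hes')
  rw [Finset.sum_congr rfl fun e _ => hval e, Finset.sum_ite_mem, Finset.univ_inter,
    Finset.sum_const, nsmul_eq_mul] at h2
  refine mul_ne_zero ?_ hne h2
  exact_mod_cast (Finset.card_pos.2 ⟨_, het⟩).ne'

theorem productStates₃_subset_productStates₂ {E F G : Type*} [NormedAddCommGroup E]
    [InnerProductSpace ℂ E] [NormedAddCommGroup F] [InnerProductSpace ℂ F]
    [NormedAddCommGroup G] [InnerProductSpace ℂ G] :
    productStates₃ E F G ⊆ productStates₂ E (F ⊗[ℂ] G) := by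
  rintro _ ⟨x, y, z, hx, hy, hz, rfl⟩
  refine ⟨x, _, hx, fun h => ?_, rfl⟩
  have hn := congrArg norm h
  rw [TensorProduct.norm_tmul, norm_zero, mul_eq_zero, norm_eq_zero, norm_eq_zero] at hn
  exact hn.elim hy hz

theorem ne_zero_of_inner_ne_zero {H : Type*} [NormedAddCommGroup H] [InnerProductSpace ℂ H]
    {v u : H} (h : innerC v u ≠ 0) : u ≠ 0 := by
  rintro rfl
  exact h (inner_zero_right v)

theorem isSUCPB_of_functional {E F : Type*} [NormedAddCommGroup E] [InnerProductSpace ℂ E]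
    [FiniteDimensional ℂ E] [NormedAddCommGroup F] [InnerProductSpace ℂ F]
    [FiniteDimensional ℂ F] {S : Set (E ⊗[ℂ] F)} (hP : S ⊆ productStates₂ E F)
    (hO : MutuallyOrthogonal S) (v : E ⊗[ℂ] F)
    (hv : ∀ x y, x ⊗ₜ[ℂ] y ∈ complementary S → innerC v (x ⊗ₜ[ℂ] y) = 0)
    {u : E ⊗[ℂ] F} (hu : u ∈ complementary S) (hvu : innerC v u ≠ 0) : IsSUCPB S := by
  refine ⟨⟨hP, hO,
    span_ne_top_of_mem_complementary hu (ne_zero_of_inner_ne_zero hvu)⟩, fun m n f g =>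
    fewOrthogonalProducts_of_functional (innerₛₗ ℂ v) hv hu hvu f g⟩

/-- The witness is a weighted difference of the uniform states of the centre tile and of one row
tile; a row tile off the middle exists because `1 ≤ m`. -/
theorem exists_centre_component (hm : 1 ≤ m) :
    ∃ u ∈ complementary (tileProductSet (layeredTiles (2 * m + 1))),
      innerC (cellState (middle m, middle m, 0)) u ≠ 0 := by
  have hT := isTileStructure_layeredTiles m
  have hi : (⟨0, by omega⟩ : Fin (2 * m + 1)) ≠ middle m := by
    rw [middle, ne_eq, Fin.mk.injEq]; omega
  have hr := rowTile_mem (c := 0) hi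
  have hmid : (middle m, middle m, (0 : Fin 2)) ∈ cells (centreTile m) :=
    mem_centreTile.2 ⟨rfl, rfl⟩
  refine ⟨_, hT.sub_mem_complementary centreTile_mem hr,
    hT.inner_cellState_sub centreTile_mem hr ?_ hmid⟩
  intro h
  rw [h] at hmid
  exact hi (mem_rowTile.1 hmid).1.symm

end Main

theorem mainTheorem3 (d : ℕ) (hd : 3 ≤ d) (hodd : Odd d) :
    (IsUTileStructure (layeredTiles d) ∧ (layeredTiles d).card = 4 * d - 3 ∧
      U1 d = tileProductSet (layeredTiles d)) ∧
    (IsUPB (productStates₃ (EuclideanSpace ℂ (Fin d)) (EuclideanSpace ℂ (Fin d))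
        (EuclideanSpace ℂ (Fin 2))) (U1 d) ∧
      (U1 d).Finite ∧ (U1 d).ncard = 2 * d ^ 2 - 4 * d + 4) ∧
    IsSUCPB_A_BC (U1 d) ∧ IsSUCPB_B_CA (U1 d) := by
  have hU := U1_eq_tileProductSet hodd
  obtain ⟨m, rfl⟩ := hodd
  have hm : 1 ≤ m := by omega
  have hT := isTileStructure_layeredTiles m
  have hcard := card_layeredTiles m
  have hsub : tileProductSet (layeredTiles (2 * m + 1)) ⊆ productStates₃ _ _ _ :=
    tileProductSet_subset (by omega) (by omega) (by omega)
  obtain ⟨u, hu, hu0⟩ := exists_centre_component hm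
  have hune : u ≠ 0 := ne_zero_of_inner_ne_zero hu0
  obtain ⟨hfin, hncard⟩ := hT.tileProductSet_finite_ncard
  refine ⟨⟨isUTileStructure_layeredTiles hm, by omega, hU⟩, ?_⟩
  rw [hU]
  refine ⟨⟨⟨⟨⟨hsub, hT.mutuallyOrthogonal, span_ne_top_of_mem_complementary hu hune⟩, ?_⟩,
    fun ψ hψ => product_notMem_complementary hψ⟩, hfin, ?_⟩, ?_, ?_⟩
  -- No product state is available at all, so it suffices that the complementary subspace contains
  -- the nonzero `u`.
  · intro T hTP hTc _
    have hempty : T = ∅ := by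
      refine Finset.eq_empty_of_forall_notMem fun ψ hψ => ?_
      exact product_notMem_complementary (hTP hψ) (hTc ψ hψ)
    rw [hempty, Finset.card_empty]
    have : Nontrivial (complementary (tileProductSet (layeredTiles (2 * m + 1)))) :=
      ⟨⟨⟨u, hu⟩, 0, fun h => hune (congrArg Subtype.val h)⟩⟩
    exact Module.finrank_pos
  · rw [hcard] at hncard
    have h1 : (2 * m + 1) * (2 * m + 1) * 2 = 8 * (m * m) + 8 * m + 2 := by ring
    have h2 : 2 * (2 * m + 1) ^ 2 = 8 * (m * m) + 8 * m + 2 := by ring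
    -- With `1 ≤ m` this ensures that the subtraction `2 * d ^ 2 - 4 * d` is not truncated.
    have h3 : m ≤ m * m := Nat.le_mul_self m
    omega
  · exact isSUCPB_of_functional (hsub.trans productStates₃_subset_productStates₂)
      hT.mutuallyOrthogonal _ inner_centre_tmul_eq_zero hu hu0
  · refine isSUCPB_of_functional ?_ ?_ _ inner_centre_rotateABC_tmul_eq_zero
      (rotateABC_mem_complementary.2 hu) (by rwa [inner_rotateABC])
    · rintro _ ⟨ψ, hψ, rfl⟩
      obtain ⟨x, y, z, hx, hy, hz, rfl⟩ := hsub hψ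
      exact productStates₃_subset_productStates₂ ⟨y, z, x, hy, hz, hx, rfl⟩
    · rintro _ ⟨φ, hφ, rfl⟩ _ ⟨χ, hχ, rfl⟩ hne
      refine (inner_rotateABC φ χ).trans (hT.mutuallyOrthogonal hφ hχ fun h => hne (by rw [h]))
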